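/- Let $N$ be a finite set of individuals. A profile over $N$ is a map $\varphi:N\times N\to\{0,1\}$; $a$ qualifies $b$ if $\varphi(a,b)=1$ and disqualifies $b$ if $\varphi(a,b)=0$. For $T\subseteq N$ and $K_0\subseteq T$ put $K_\ell=K_{\ell-1}\cup\{a\in T:\exists b\in K_{\ell-1},\ \varphi(b,a)=1\}$ for $\ell\ge 1$, and let $f(\varphi,T)=K_\ell$ for an $\ell\geq 1$ with $K_\ell=K_{\ell-1}$. The rule obtained from $K_0=\{a\in T:\varphi(b,a)=1\text{ for all }b\in T\}$ is the consensus-start-respecting rule $f^{\mathrm{CSR}}$, and the rule obtained from $K_0=\{a\in T:\varphi(a,a)=1\}$ is the liberal-start-respecting rule $f^{\mathrm{LSR}}$. For a rule $f$, an instance of Group Control by Adding Individuals (GCAI) for $f$ is a tuple $(N,\varphi,S,T,k)$ consisting of a finite set $N$, a profile $\varphi$ over $N$, nonempty sets $S\subseteq T\subseteq N$ and an integer $k$ (written in binary); the question is whether there is a set $U\subseteq N\setminus T$ with $|U|\le k$ and $S\subseteq f(\varphi,T\cup U)$. A profile $\varphi$ over $N$ is disqualifying consecutive (DQC) if there is a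 linear order $(a_1,\dots,a_n)$ of $N$ such that, for every $a\in N$, the indices $x$ with $\varphi(a,a_x)=0$ are consecutive, that is, form a (possibly empty) interval of $\{1,\dots,n\}$. **Theorem.** GCAI for $f^{\mathrm{CSR}}$ and GCAI for $f^{\mathrm{LSR}}$, each restricted to instances whose profile is DQC, are solvable in polynomial time: for each of the two rules there are a deterministic Turing machine and a polynomial $p$ such that on every instance $(N,\varphi,S,T,k)$ with $\varphi$ DQC, given by an encoding of length $L$ (the linear order is not part of the input), the machine halts after at most $p(L)$ steps with the correct answer to the question of GCAI. -/

import Mathlib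

namespace GroupIdent

/-! ### Profiles and the two procedural rules -/

/-- A profile over `N`: `φ a b = true` (resp. `false`) means that `a` qualifies (resp. disqualifies)
`b`. -/
abbrev Profile (N : Type) : Type := N → N → Bool

/-- A social aggregation rule assigns to every profile `φ` over a set of individuals and every
subset `T` of individuals a subset of `T`, the socially qualified individuals. -/
structure SocialAggregationRule where
  select : {N : Type} → [DecidableEq N] → Profile N → Finset N → Finset N
  select_subset : ∀ {N : Type} [DecidableEq N] (φ : Profile N) (T : Finset N), select φ T ⊆ T

section Procedure

variable {N : Type} [DecidableEq N]

/-- One iteration: add to `K` all members of `T` that are qualified by some member of `K`. -/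
def extend (φ : Profile N) (T K : Finset N) : Finset N :=
  K ∪ T.filter (fun a => ∃ b ∈ K, φ b a = true)

/-- The set `K_ℓ` obtained from the initial set `K₀` after `ℓ` iterations. -/
def stage (φ : Profile N) (T K₀ : Finset N) : ℕ → Finset N
  | 0 => K₀
  | ℓ + 1 => extend φ T (stage φ T K₀ ℓ)

theorem stage_subset (φ : Profile N) {T K₀ : Finset N} (h : K₀ ⊆ T) (ℓ : ℕ) :
    stage φ T K₀ ℓ ⊆ T := by
  induction ℓ with
  | zero => exact h
  | succ ℓ ih => exact Finset.union_subset ih (Finset.filter_subset _ _)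

theorem stage_stabilizes (φ : Profile N) {T K₀ : Finset N} (h : K₀ ⊆ T) :
    ∃ ℓ, stage φ T K₀ (ℓ + 1) = stage φ T K₀ ℓ := by
  by_contra! hne
  have hcard : ∀ ℓ, ℓ ≤ (stage φ T K₀ ℓ).card := by
    intro ℓ
    induction ℓ with
    | zero => exact Nat.zero_le _
    | succ ℓ ih =>
      have hlt : stage φ T K₀ ℓ ⊂ stage φ T K₀ (ℓ + 1) :=
        Finset.ssubset_iff_subset_ne.2 ⟨Finset.subset_union_left, (hne ℓ).symm⟩
      exact lt_of_le_of_lt ih (Finset.card_lt_card hlt)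
  have h1 := hcard (T.card + 1)
  have h2 := Finset.card_le_card (stage_subset φ h (T.card + 1))
  omega

/-- The result of the iteration: the set `K_ℓ` at the first `ℓ` with `K_{ℓ+1} = K_ℓ`. -/
def limitStage (φ : Profile N) {T K₀ : Finset N} (h : K₀ ⊆ T) : Finset N :=
  stage φ T K₀ (Nat.find (stage_stabilizes φ h))

/-- Initial set of the consensus-start-respecting rule: the members of `T` qualified by all members
of `T`. -/
def consensusStart (φ : Profile N) (T : Finset N) : Finset N :=
  T.filter (fun a => ∀ b ∈ T, φ b a = true)

/-- Initial set of the liberal-start-respecting rule: the members of `T` qualifying themselves. -/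
def liberalStart (φ : Profile N) (T : Finset N) : Finset N :=
  T.filter (fun a => φ a a = true)

end Procedure

/-- The consensus-start-respecting rule. -/
def csr : SocialAggregationRule where
  select φ T := limitStage (T := T) (K₀ := consensusStart φ T) φ (Finset.filter_subset _ _)
  select_subset φ _ := stage_subset φ (Finset.filter_subset _ _) _

/-- The liberal-start-respecting rule. -/
def lsr : SocialAggregationRule where
  select φ T := limitStage (T := T) (K₀ := liberalStart φ T) φ (Finset.filter_subset _ _)
  select_subset φ _ := stage_subset φ (Finset.filter_subset _ _) _

/-! ### The disqualifying-consecutive domain -/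

/-- `φ` is DQC: the individuals can be listed as `a₁, …, aₙ` in such a way that for every
individual `a` the positions `x` with `φ a aₓ = 0` are consecutive (an interval, possibly empty). -/
def IsDQC {N : Type} [Fintype N] (φ : Profile N) : Prop :=
  ∃ e : Fin (Fintype.card N) ≃ N, ∀ a : N, Set.OrdConnected {x | φ a (e x) = false}

/-! ### Group control by adding individuals -/

/-- An instance `(N, φ, S, T, k)`, the individuals being numbered `0, …, n - 1`. -/
structure Instance where
  n : ℕ
  φ : Profile (Fin n)
  S : Finset (Fin n)
  T : Finset (Fin n)
  k : ℤ
  S_nonempty : S.Nonempty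
  T_nonempty : T.Nonempty
  S_subset_T : S ⊆ T

/-- The question of GCAI for the rule `f`. -/
def Instance.IsYes (f : SocialAggregationRule) (I : Instance) : Prop :=
  ∃ U : Finset (Fin I.n), U ⊆ Finset.univ \ I.T ∧ (U.card : ℤ) ≤ I.k ∧
    I.S ⊆ f.select I.φ (I.T ∪ U)

/-! ### Encoding of instances and polynomial-time solvability -/

/-- A `0`-`1` vector, followed by the separator `none`. -/
def encodeVec {n : ℕ} (v : Fin n → Bool) : List (Option Bool) :=
  (List.ofFn v).map some ++ [none]

/-- An integer: a sign bit, followed by the absolute value in binary. -/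
def encodeInt (k : ℤ) : List (Option Bool) :=
  some (decide (k < 0)) :: (Computability.encodeNat k.natAbs).map some

/-- The input string of an instance over the alphabet `{0, 1, separator}`: the rows of the `0`-`1`
matrix of the profile, the characteristic vectors of `S` and `T`, and `k` in binary. -/
def Instance.encode (I : Instance) : List (Option Bool) :=
  (List.finRange I.n).flatMap (fun a => encodeVec (I.φ a)) ++
    encodeVec (fun a => decide (a ∈ I.S)) ++ encodeVec (fun a => decide (a ∈ I.T)) ++
    encodeInt I.k

/-- The decision problem `Q`, with inputs given through the encoding `enc`, is solvable in
polynomial time when restricted to the inputs in `D`: some Turing machine answers correctly on each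
input in `D`, in time bounded by a polynomial in the length of its encoding. -/
def PolyTimeSolvableOn {α Γ : Type} (enc : α → List Γ) (D Q : α → Prop) : Prop :=
  ∃ f : {x : α // D x} → Bool, (∀ x, f x = true ↔ Q x.1) ∧
    Nonempty (Turing.TM2ComputableInPolyTime (fun x : {x : α // D x} => enc x.1)
      Computability.encodeBool f)

end GroupIdent

/-! Listed along the DQC order, the members of `S` disqualified by a given individual are
consecutive in `S`. Sets of this kind that meet pairwise have a common element (Helly's theorem on
the line). Hence, if every member of `S` is qualified by some member of a set `K`, two members of
`K` already suffice (`IsDQC.exists_pair`). Take for `K` the socially qualified individuals: GCAI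
asks whether two individuals `a`, `b` can be made socially qualified within the budget such that
each `s ∈ S` is qualified by `a` or by `b`. Since `S ⊆ T`, the members of `S` themselves cost
nothing. For the consensus rule a member `c` of the initial set is guessed and only individuals
qualifying `c` are admitted; then social qualification is reachability from a virtual root. For the
liberal rule `c` plays no role.

The cheapest set through which two targets can be reached from a root is found by moving two tokens,
which pay once for an individual that they enter together (`Pair.of_reach`, `Pair.exists_reach`).
This gives `Instance.isYes_iff`. A state consists of `c`, the cost `j` and the two positions, all
less than the input length `L`, because costs above `n` are never needed. The reachable states are a
least fixed point on a table with about `L ^ 4` cells. Further cells compare `j` with the binary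
number `k`, digit by digit.

For the Turing machine, structured stack programs are compiled to `TM2` machines
(`Cmd.polyTime_of_runs`). A fixed formula with quantifiers bounded by `L` is evaluated in polynomial
time (`Fml.exists_runs_code`), and iterating a monotone formula on a table saturates after as many
rounds as there are cells (`cell_iterate_of_eval`). The linear order enters only the proof of
correctness; the machine never looks for it. -/

namespace GroupIdent

open Function (update)

/-! ### A structured language for stack machines -/

/-- The symbols on the work stacks: the input alphabet. -/
abbrev Sym : Type := Option Bool

/-- The stacks: input, table, table under construction, counters for the iteration and for the
address being filled, scratch stacks for evaluating terms and reading cells, and variables. -/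
inductive Stack
  | inp | tab | fresh | fuel | idx
  | adr | cnt | mlt | buf
  | vn | vc | vj | va | vb | vx | vi
  deriving DecidableEq

instance : Fintype Stack where
  elems := {.inp, .tab, .fresh, .fuel, .idx, .adr, .cnt, .mlt, .buf,
    .vn, .vc, .vj, .va, .vb, .vx, .vi}
  complete k := by cases k <;> decide

/-- The finite memory: the last symbol popped (`none` if the stack was empty) and a flag. -/
abbrev Reg : Type := Option Sym × Bool

abbrev Stacks : Type := Stack → List Sym

/-- Structured programs on stacks. -/
inductive Cmd
  | push (k : Stack) (f : Reg → Sym)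
  | pop (k : Stack)
  | load (f : Reg → Reg)
  | seq (c d : Cmd)
  | ite (p : Reg → Bool) (c d : Cmd)
  | loop (p : Reg → Bool) (c : Cmd)

/-- `Runs c v S v' S' t`: started with memory `v` and stacks `S`, the program `c` ends with memory
`v'` and stacks `S'` after at most `t` steps. -/
inductive Runs : Cmd → Reg → Stacks → Reg → Stacks → ℕ → Prop
  | push (k f v S) : Runs (.push k f) v S v (Function.update S k (f v :: S k)) 1
  | pop (k v S) : Runs (.pop k) v S ((S k).head?, v.2) (Function.update S k (S k).tail) 1
  | load (f v S) : Runs (.load f) v S (f v) S 1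
  | seq {c d v S v₁ S₁ t₁ v₂ S₂ t₂} (h₁ : Runs c v S v₁ S₁ t₁) (h₂ : Runs d v₁ S₁ v₂ S₂ t₂) :
      Runs (.seq c d) v S v₂ S₂ (t₁ + t₂)
  | iteTrue {p c d v S v' S' t} (hp : p v = true) (h : Runs c v S v' S' t) :
      Runs (.ite p c d) v S v' S' (t + 1)
  | iteFalse {p c d v S v' S' t} (hp : p v = false) (h : Runs d v S v' S' t) :
      Runs (.ite p c d) v S v' S' (t + 1)
  | loopDone {p c v S} (hp : p v = false) : Runs (.loop p c) v S v S 1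
  | loopStep {p c v S v₁ S₁ t₁ v₂ S₂ t₂} (hp : p v = true) (h₁ : Runs c v S v₁ S₁ t₁)
      (h₂ : Runs (.loop p c) v₁ S₁ v₂ S₂ t₂) : Runs (.loop p c) v S v₂ S₂ (t₁ + t₂ + 1)
  | weaken {c v S v' S' t t'} (h : Runs c v S v' S' t) (ht : t ≤ t') : Runs c v S v' S' t'

/-! ### Compilation of stack programs to Turing machines -/

namespace Cmd

/-- The labels needed for a program. -/
def Lab : Cmd → Type
  | push _ _ => Unit
  | pop _ => Unit
  | load _ => Unit
  | seq c d => c.Lab ⊕ d.Lab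
  | ite _ c d => Option (c.Lab ⊕ d.Lab)
  | loop _ c => Option c.Lab

@[reducible] def labFintype : (c : Cmd) → Fintype c.Lab
  | push _ _ => inferInstanceAs (Fintype Unit)
  | pop _ => inferInstanceAs (Fintype Unit)
  | load _ => inferInstanceAs (Fintype Unit)
  | seq c d =>
    letI := c.labFintype
    letI := d.labFintype
    inferInstanceAs (Fintype (c.Lab ⊕ d.Lab))
  | ite _ c d =>
    letI := c.labFintype
    letI := d.labFintype
    inferInstanceAs (Fintype (Option (c.Lab ⊕ d.Lab)))
  | loop _ c =>
    letI := c.labFintype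
    inferInstanceAs (Fintype (Option c.Lab))

instance (c : Cmd) : Fintype c.Lab := c.labFintype

/-- The label at which a program starts. -/
def entry : (c : Cmd) → c.Lab
  | push _ _ => ()
  | pop _ => ()
  | load _ => ()
  | seq c _ => Sum.inl c.entry
  | ite _ _ _ => none
  | loop _ _ => none

/-- The stack alphabets of the Turing machine: the output stack is `none`. -/
abbrev Alph : Option Stack → Type
  | none => Bool
  | some _ => Sym

/-- The statements at the labels of a program, the labels being embedded by `ι` into those of a
machine in which the program is left for the label `ex`. -/
def code {Λ : Type} : (c : Cmd) → (c.Lab → Λ) → Λ → c.Lab → Turing.TM2.Stmt Alph Λ Reg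
  | push k f, _, ex, _ => .push (some k) f (.goto fun _ => ex)
  | pop k, _, ex, _ => .pop (some k) (fun v s => (s, v.2)) (.goto fun _ => ex)
  | load f, _, ex, _ => .load f (.goto fun _ => ex)
  | seq c d, ι, _, .inl l => c.code (fun l => ι (.inl l)) (ι (.inr d.entry)) l
  | seq _ d, ι, ex, .inr l => d.code (fun l => ι (.inr l)) ex l
  | ite p c d, ι, _, none =>
    .branch p (.goto fun _ => ι (some (.inl c.entry))) (.goto fun _ => ι (some (.inr d.entry)))
  | ite _ c _, ι, ex, some (.inl l) => c.code (fun l => ι (some (.inl l))) ex l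
  | ite _ _ d, ι, ex, some (.inr l) => d.code (fun l => ι (some (.inr l))) ex l
  | loop p c, ι, ex, none => .branch p (.goto fun _ => ι (some c.entry)) (.goto fun _ => ex)
  -- The exit of the body is the label of the test.
  | loop _ c, ι, _, some l => c.code (fun l => ι (some l)) (ι none) l

/-- The stacks of the machine, the output stack being empty. -/
def fullStacks (S : Stacks) : (k : Option Stack) → List (Alph k)
  | none => []
  | some k => S k

theorem update_fullStacks (S : Stacks) (k : Stack) (l : List Sym) :
    Function.update (fullStacks S) (some k) l = fullStacks (Function.update S k l) := by
  funext q
  rcases q with _ | q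
  · rw [Function.update_of_ne (by simp)]; rfl
  · by_cases h : q = k
    · subst h; simp [fullStacks]
    · rw [Function.update_of_ne (by simpa using h)]
      simp [fullStacks, h]

/-- The configuration of the machine at the label `l`. -/
def cfg {Λ : Type} (l : Λ) (v : Reg) (S : Stacks) : Turing.TM2.Cfg Alph Λ Reg :=
  ⟨some l, v, fullStacks S⟩

theorem step_branch {Λ : Type} {M : Λ → Turing.TM2.Stmt Alph Λ Reg} {l a b : Λ} {p : Reg → Bool}
    (h : M l = .branch p (.goto fun _ => a) (.goto fun _ => b)) (v : Reg) (S : Stacks) :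
    Turing.TM2.step M (cfg l v S) = some (cfg (cond (p v) a b) v S) := by
  change some (Turing.TM2.stepAux (M l) _ _) = _
  rw [h]
  cases hp : p v <;> simp [cfg, hp]

/-- A run of a program is simulated by every machine containing it. -/
theorem exists_steps {Λ : Type} (M : Λ → Turing.TM2.Stmt Alph Λ Reg) {c : Cmd} {v v' : Reg}
    {S S' : Stacks} {t : ℕ} (h : Runs c v S v' S' t) :
    ∀ (ι : c.Lab → Λ) (ex : Λ), (∀ l, M (ι l) = c.code ι ex l) →
      ∃ s ≤ t, (flip bind (Turing.TM2.step M))^[s] (some (cfg (ι c.entry) v S)) =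
        some (cfg ex v' S') := by
  induction h with
  | push k f v S =>
    intro ι ex hM
    refine ⟨1, le_rfl, ?_⟩
    change some (Turing.TM2.stepAux (M (ι _)) _ _) = _
    rw [hM]
    simp only [code, Turing.TM2.stepAux]
    rw [show fullStacks S (some k) = S k from rfl, update_fullStacks]; rfl
  | pop k v S =>
    intro ι ex hM
    refine ⟨1, le_rfl, ?_⟩
    change some (Turing.TM2.stepAux (M (ι _)) _ _) = _
    rw [hM]
    simp only [code, Turing.TM2.stepAux]
    rw [show fullStacks S (some k) = S k from rfl, update_fullStacks]; rfl
  | load f v S =>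
    intro ι ex hM
    refine ⟨1, le_rfl, ?_⟩
    change some (Turing.TM2.stepAux (M (ι _)) _ _) = _
    rw [hM]; rfl
  | @seq c d _ _ _ _ _ _ _ _ _ _ ih₁ ih₂ =>
    intro ι ex hM
    obtain ⟨s₁, hs₁, e₁⟩ := ih₁ (fun l => ι (.inl l)) (ι (.inr d.entry)) fun l => hM (.inl l)
    obtain ⟨s₂, hs₂, e₂⟩ := ih₂ (fun l => ι (.inr l)) ex fun l => hM (.inr l)
    refine ⟨s₂ + s₁, by omega, ?_⟩
    rw [Function.iterate_add_apply]
    exact (congrArg _ e₁).trans e₂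
  | @iteTrue p c d v S _ _ _ hp _ ih =>
    intro ι ex hM
    obtain ⟨s, hs, e⟩ := ih (fun l => ι (some (.inl l))) ex fun l => hM (some (.inl l))
    refine ⟨s + 1, by omega, ?_⟩
    rw [Function.iterate_add_apply]
    refine (congrArg _ ?_).trans e
    exact (step_branch (hM (none : Option _)) v S).trans (by rw [hp]; rfl)
  | @iteFalse p c d v S _ _ _ hp _ ih =>
    intro ι ex hM
    obtain ⟨s, hs, e⟩ := ih (fun l => ι (some (.inr l))) ex fun l => hM (some (.inr l))
    refine ⟨s + 1, by omega, ?_⟩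
    rw [Function.iterate_add_apply]
    refine (congrArg _ ?_).trans e
    exact (step_branch (hM (none : Option _)) v S).trans (by rw [hp]; rfl)
  | @loopDone p c v S hp =>
    intro ι ex hM
    refine ⟨1, le_rfl, ?_⟩
    exact (step_branch (hM (none : Option _)) v S).trans (by rw [hp]; rfl)
  | @loopStep p c v S _ _ _ _ _ _ hp _ _ ih₁ ih₂ =>
    intro ι ex hM
    obtain ⟨s₁, hs₁, e₁⟩ := ih₁ (fun l => ι (some l)) (ι none) fun l => hM (some l)
    obtain ⟨s₂, hs₂, e₂⟩ := ih₂ ι ex hM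
    refine ⟨s₂ + (s₁ + 1), by omega, ?_⟩
    rw [Function.iterate_add_apply, Function.iterate_add_apply]
    refine (congrArg _ ((congrArg _ ?_).trans e₁)).trans e₂
    exact (step_branch (hM (none : Option _)) v S).trans (by rw [hp]; rfl)
  | weaken _ ht ih =>
    intro ι ex hM
    obtain ⟨s, hs, e⟩ := ih ι ex hM
    exact ⟨s, hs.trans ht, e⟩

/-- The initial memory. -/
def initReg : Reg := (none, false)

/-- The Turing machine of a program: at the end the flag is written to the output stack. -/
def machine (c : Cmd) : Turing.FinTM2 where
  K := Option Stack
  k₀ := some .inp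
  k₁ := none
  Γ := Alph
  Λ := Option c.Lab
  main := some c.entry
  σ := Reg
  initialState := initReg
  Γk₀Fin := inferInstanceAs (Fintype (Option Bool))
  m
    -- The memory is reset because a halting configuration with given output has, by definition, the
    -- initial memory and all other stacks empty.
    | none => .push none (fun v : Reg => v.2) (.load (fun _ => initReg) .halt)
    | some l => c.code some none l

/-- The stacks holding just the input. -/
def initStacks (w : List Sym) : Stacks := Function.update (fun _ => []) .inp w

/-- A program that runs for polynomial time, empties all stacks and leaves the value of `f` in the
flag yields a polynomial-time Turing machine computing `f`. -/
theorem polyTime_of_runs {α : Type} (enc : α → List Sym) (f : α → Bool) (c : Cmd)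
    (P : Polynomial ℕ)
    (h : ∀ x, ∃ u, Runs c initReg (initStacks (enc x)) (u, f x) (fun _ => [])
      (P.eval (enc x).length)) :
    Nonempty (Turing.TM2ComputableInPolyTime enc Computability.encodeBool f) := by
  choose u hu using h
  have key : ∀ x, ∃ s ≤ P.eval (enc x).length,
      (flip bind (Turing.TM2.step (machine c).m))^[s]
        (some (cfg (some c.entry) initReg (initStacks (enc x)))) =
          some (cfg none (u x, f x) fun _ => []) :=
    fun x => exists_steps (machine c).m (hu x) some none fun _ => rfl
  choose s hs e using key
  have hi : ∀ x, Turing.initList (machine c) (enc x) =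
      cfg (some c.entry) initReg (initStacks (enc x)) := by
    intro x
    refine congrArg (Turing.TM2.Cfg.mk _ _) (funext fun k => ?_)
    rcases k with _ | k
    · rfl
    · by_cases hk : k = .inp
      · subst hk; simp [initStacks, fullStacks, machine]; rfl
      · simp [initStacks, fullStacks, machine, hk]
  -- The extra step is the one at the final label `none`, which writes the output.
  refine ⟨⟨⟨machine c, Equiv.refl _, Equiv.refl _⟩, P + 1, fun x => ⟨⟨1 + s x, ?_⟩, ?_⟩⟩⟩
  · have hm : List.map (Equiv.refl (Option Bool)).invFun (enc x) = enc x := List.map_id _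
    rw [Function.iterate_add_apply]
    refine (congrArg _ ((congrArg (fun z => (flip bind (Turing.TM2.step (machine c).m))^[s x]
      (some z)) ?_).trans (e x))).trans ?_
    · exact (congrArg _ hm).trans (hi x)
    · refine congrArg some (congrArg (Turing.TM2.Cfg.mk none initReg) (funext fun k => ?_))
      rcases k with _ | k
      · rfl
      · exact Function.update_of_ne (Option.some_ne_none k) _ _
  · simp; have := hs x; omega

end Cmd

theorem Runs.of_eq {c v v₁ v' v₁' t t₁} {S S₁ S' S₁' : Stacks} (h : Runs c v S v' S' t)
    (hv : v = v₁) (hS : S = S₁) (hv' : v' = v₁') (hS' : S' = S₁') (ht : t ≤ t₁) :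
    Runs c v₁ S₁ v₁' S₁' t₁ := by
  subst hv hS hv' hS'
  exact h.weaken ht

/-! ### Basic stack programs and their running times -/

namespace Cmd

/-- The symbol popped last. -/
def popped (v : Reg) : Sym := v.1.getD none

def skip : Cmd := .load id

/-- Pop the symbols of the stack `k` one by one and execute `c` after each. -/
def forEach (k : Stack) (c : Cmd) : Cmd :=
  .seq (.pop k) (.loop (fun v => v.1.isSome) (.seq c (.pop k)))

/-- The loop rule: `X p l` is the state in which the symbols `p` have been popped (the last one
first) and the symbols `l` are left. -/
theorem runs_forEach {k : Stack} {c : Cmd} {T : ℕ} (X : List Sym → List Sym → Bool × Stacks)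
    (hk : ∀ p l, (X p l).2 k = l) (L : List Sym)
    (h : ∀ p x l, p.reverse ++ x :: l = L → ∃ u, Runs c (some x, (X p (x :: l)).1)
      (update (X p (x :: l)).2 k l) (u, (X (x :: p) l).1) (X (x :: p) l).2 T) (u : Option Sym) :
    Runs (forEach k c) (u, (X [] L).1) (X [] L).2 (none, (X L.reverse []).1) (X L.reverse []).2
      ((T + 2) * L.length + 2) := by
  have key : ∀ l p, p.reverse ++ l = L →
      Runs (.loop (fun v => v.1.isSome) (.seq c (.pop k))) (l.head?, (X p l).1)
        (update (X p l).2 k l.tail) (none, (X L.reverse []).1) (X L.reverse []).2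
        ((T + 2) * l.length + 1) := by
    intro l
    induction l with
    | nil =>
      intro p hp
      rw [List.append_nil] at hp
      have hp' : p = L.reverse := by rw [← hp, List.reverse_reverse]
      refine (Runs.loopDone ?_).of_eq rfl rfl ?_ ?_ (by simp)
      · rfl
      · simp [hp']
      · rw [List.tail_nil, hp']
        exact Function.update_eq_iff.2 ⟨(hk _ _).symm, fun _ _ => rfl⟩
    | cons x l ih =>
      intro p hp
      obtain ⟨u, hu⟩ := h p x l hp
      have hpop := Runs.pop k (u, (X (x :: p) l).1) (X (x :: p) l).2
      rw [hk] at hpop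
      refine (Runs.loopStep rfl (hu.seq hpop) (ih (x :: p) (by simpa using hp))).weaken ?_
      simp only [List.length_cons]
      ring_nf
      omega
  have hpop := Runs.pop k (u, (X [] L).1) (X [] L).2
  rw [hk] at hpop
  exact (hpop.seq (key L [] rfl)).weaken (by omega)

/-- Move the symbols of `k` to `k'`, reversing their order. -/
def move (k k' : Stack) : Cmd := forEach k (.push k' popped)

theorem runs_move {k k' : Stack} (hk : k ≠ k') (u : Option Sym) (r : Bool) (S : Stacks) :
    Runs (move k k') (u, r) S (none, r)
      (update (update S k []) k' ((S k).reverse ++ S k')) (3 * (S k).length + 2) := by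
  have := runs_forEach (k := k) (c := .push k' popped) (T := 1)
    (fun p l => (r, update (update S k l) k' (p ++ S k'))) (by simp [hk]) (S k)
    (fun p x l _ => ⟨some x, (Runs.push _ _ _ _).of_eq rfl rfl rfl (by
      funext q
      simp only [Function.update_apply]
      split_ifs <;> simp_all [popped]) le_rfl⟩) u
  exact this.of_eq rfl (by simp) rfl (by simp) le_rfl

/-- Empty the stack `k`. -/
def clear (k : Stack) : Cmd := forEach k skip

theorem runs_clear (k : Stack) (u : Option Sym) (r : Bool) (S : Stacks) :
    Runs (clear k) (u, r) S (none, r) (update S k []) (3 * (S k).length + 2) := by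
  have := runs_forEach (k := k) (c := skip) (T := 1)
    (fun _ l => (r, update S k l)) (by simp) (S k)
    (fun p x l _ => ⟨some x, (Runs.load _ _ _).of_eq rfl rfl rfl (by simp) le_rfl⟩) u
  exact this.of_eq rfl (by simp) rfl (by simp) le_rfl

/-- Add as many marks to `k'` as `k` has symbols. -/
def copyLen (k k' : Stack) : Cmd :=
  .seq (forEach k (.seq (.push .cnt popped) (.push k' fun _ => none))) (move .cnt k)

/-- Counting a stack destroys it, so its symbols are saved in reverse on `cnt`; moving them back
restores their order. -/
theorem runs_copyLen {k k' : Stack} (hk : k ≠ k') (h : k ≠ .cnt) (h' : k' ≠ .cnt)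
    (u : Option Sym) (r : Bool) (S : Stacks) (hS : S .cnt = []) :
    Runs (copyLen k k') (u, r) S (none, r)
      (update S k' (List.replicate (S k).length none ++ S k')) (7 * (S k).length + 4) := by
  have := runs_forEach (k := k) (c := .seq (.push .cnt popped) (.push k' fun _ => none)) (T := 2)
    (fun p l => (r, update (update (update S k l) .cnt p) k'
      (List.replicate p.length none ++ S k'))) (by simp [hk, h]) (S k)
    (fun p x l _ => ⟨some x, ((Runs.push _ _ _ _).seq (Runs.push _ _ _ _)).of_eq rfl rfl rfl (by
      funext q
      simp only [Function.update_apply]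
      split_ifs <;> simp_all [popped, List.replicate_succ]) le_rfl⟩) u
  refine (this.seq (runs_move h.symm _ _ _)).of_eq rfl ?_ rfl ?_ ?_
  · funext q
    simp only [Function.update_apply]
    split_ifs <;> simp_all
  · funext q
    simp only [Function.update_apply]
    split_ifs <;> simp_all
  · simp [h'.symm]
    omega

/-- Multiply the number of marks on `adr` by the number of symbols on `k`. -/
def mulLen (k : Stack) : Cmd :=
  .seq (move .adr .mlt) (forEach .mlt (copyLen k .adr))

/-- The old marks of `adr` serve as a loop counter on `mlt`, and each of them contributes the length
of `k`. -/
theorem runs_mulLen {k : Stack} (h₁ : k ≠ .adr) (h₂ : k ≠ .cnt) (h₃ : k ≠ .mlt)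
    (u : Option Sym) (r : Bool) (S : Stacks) (hc : S .cnt = []) (hm : S .mlt = []) :
    Runs (mulLen k) (u, r) S (none, r)
      (update S .adr (List.replicate ((S .adr).length * (S k).length) none))
      (3 * (S .adr).length + 4 + (7 * (S k).length + 6) * (S .adr).length) := by
  have := runs_forEach (k := .mlt) (c := copyLen k .adr) (T := 7 * (S k).length + 4)
    (fun p l => (r, update (update S .mlt l) .adr
      (List.replicate (p.length * (S k).length) none))) (by simp) (S .adr).reverse
    (fun p x l _ => ⟨none, by
      refine (runs_copyLen h₁ h₂ (by decide) _ _ _ ?_).of_eq rfl rfl rfl ?_ ?_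
      · simp [hc]
      · funext q
        simp only [Function.update_apply]
        split_ifs <;> simp_all [Nat.add_mul, Nat.add_comm]
      · simp [h₁, h₃]⟩) none
  refine ((runs_move (by decide) u r S).seq (this.of_eq rfl ?_ rfl rfl le_rfl)).of_eq rfl rfl rfl
    ?_ ?_
  · funext q
    simp only [Function.update_apply]
    split_ifs <;> simp_all
  · funext q
    simp only [Function.update_apply]
    split_ifs <;> simp_all
  · simp only [List.length_reverse]
    ring_nf
    omega

end Cmd

/-! ### Terms and formulas over the stacks -/

/-- The stacks used in the evaluation of formulas, empty before and after it. -/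
def Stack.scratch : Stack → Bool
  | adr | cnt | mlt | buf => true
  | _ => false

/-- One operation on an address: add or multiply by the length of a stack, or add one. -/
inductive Step
  | add (k : Stack)
  | mul (k : Stack)
  | inc

namespace Step

def val (S : Stacks) : Step → ℕ → ℕ
  | add k, v => v + (S k).length
  | mul k, v => v * (S k).length
  | inc, v => v + 1

def ok : Step → Bool
  | add k => !k.scratch
  | mul k => !k.scratch
  | inc => true

def code : Step → Cmd
  | add k => .copyLen k .adr
  | mul k => .mulLen k
  | inc => .push .adr fun _ => none

/-- One bound for all three operations, so that bounds for longer terms arise by substituting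
polynomials. -/
theorem val_le {S : Stacks} {B v : ℕ} (hB : ∀ k, (S k).length ≤ B) (hv : v ≤ B) (s : Step) :
    s.val S v ≤ B * B + B + 1 := by
  rcases s with k | k | _ <;> simp only [val]
  · have := hB k
    nlinarith
  · have := Nat.mul_le_mul hv (hB k)
    omega
  · nlinarith

theorem runs_code {s : Step} (hs : s.ok) {B v : ℕ} {S : Stacks} (r : Bool)
    (hB : ∀ k, (S k).length ≤ B) (hv : v ≤ B) (h : ∀ k, k.scratch → S k = []) :
    Runs s.code (none, r) (update S .adr (List.replicate v none)) (none, r)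
      (update S .adr (List.replicate (s.val S v) none)) (7 * B * B + 9 * B + 4) := by
  have hc := h .cnt rfl
  have hm := h .mlt rfl
  rcases s with k | k | _
  · have hk : k ≠ .adr := by rintro rfl; cases hs
    have hk' : k ≠ .cnt := by rintro rfl; cases hs
    refine (Cmd.runs_copyLen hk hk' (by decide) _ _ _ (by simp [hc])).of_eq rfl rfl rfl ?_ ?_
    · simp [hk, val, Nat.add_comm]
    · have := hB k
      simp only [Function.update_of_ne hk]
      nlinarith
  · have hk : k ≠ .adr := by rintro rfl; cases hs
    have hk' : k ≠ .cnt := by rintro rfl; cases hs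
    have hk'' : k ≠ .mlt := by rintro rfl; cases hs
    refine (Cmd.runs_mulLen hk hk' hk'' _ _ _ (by simp [hc]) (by simp [hm])).of_eq rfl rfl rfl ?_ ?_
    · simp [hk, val]
    · have := Nat.mul_le_mul (hB k) hv
      simp only [Function.update_of_ne hk, Function.update_self, List.length_replicate]
      nlinarith
  · refine (Runs.push _ _ _ _).of_eq rfl rfl rfl ?_ (by omega)
    simp [val, List.replicate_succ]

end Step

/-- A term: operations to be executed one after the other, starting from zero. -/
abbrev Term := List Step

namespace Term

def valFrom (S : Stacks) (t : Term) (v : ℕ) : ℕ := t.foldl (fun v s => s.val S v) v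

/-- The value of a term. -/
def val (S : Stacks) (t : Term) : ℕ := t.valFrom S 0

def ok (t : Term) : Bool := t.all Step.ok

def code : Term → Cmd
  | [] => .skip
  | s :: t => .seq s.code (code t)

/-- The starting value `v` is arbitrary because a term is evaluated by accumulation. A single `q`
bounds both value and time, since the value is also the number of marks that later programs must
process. -/
theorem exists_runs_code (t : Term) (ht : t.ok) : ∃ q : Polynomial ℕ, ∀ (B v : ℕ) (S : Stacks)
    (r : Bool), (∀ k, (S k).length ≤ B) → v ≤ B → (∀ k, k.scratch → S k = []) →
    t.valFrom S v ≤ q.eval B ∧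
    Runs (code t) (none, r) (update S .adr (List.replicate v none)) (none, r)
      (update S .adr (List.replicate (t.valFrom S v) none)) (q.eval B) := by
  induction t with
  | nil =>
    refine ⟨.X + 1, fun B v S r _ hv _ => ⟨?_, ?_⟩⟩
    · simp [valFrom]; omega
    · exact (Runs.load _ _ _).of_eq rfl rfl rfl rfl (by simp)
  | cons s t ih =>
    have ht' : s.ok = true ∧ ok t = true := by simpa [ok] using ht
    obtain ⟨q, hq⟩ := ih ht'.2
    -- After the first operation the accumulator is bounded by `B * B + B + 1` only, which becomes
    -- the bound for the rest of the term.
    refine ⟨q.comp (.X * .X + .X + 1) + (7 * .X * .X + 9 * .X + 4), fun B v S r hB hv h => ?_⟩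
    obtain ⟨h₁, h₂⟩ := hq (B * B + B + 1) (s.val S v) S r (fun k => (hB k).trans (by nlinarith))
      (s.val_le hB hv) h
    refine ⟨h₁.trans ?_, ((Step.runs_code ht'.1 r hB hv h).seq h₂).of_eq rfl rfl rfl rfl ?_⟩
    · simp
    · simp; omega

end Term

/-- Formulas over the stacks: conditions on the symbol of a stack at the address given by a term,
and quantification, by means of a stack, over the numbers less than the length of the input. -/
inductive Fml
  | get (k : Stack) (t : Term) (f : Option Sym → Bool)
  | not (φ : Fml)
  | and (φ ψ : Fml)
  | ex (k : Stack) (φ : Fml)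

namespace Fml

def eval : Fml → Stacks → Bool
  | get k t f, S => f ((S k)[t.val S]?)
  | not φ, S => !φ.eval S
  | and φ ψ, S => φ.eval S && ψ.eval S
  | ex k φ, S => decide (∃ i < (S .inp).length, φ.eval (update S k (List.replicate i none)) = true)

/-- The stacks used for quantification. -/
def bound : Fml → List Stack
  | get _ _ _ => []
  | not φ => φ.bound
  | and φ ψ => φ.bound ++ ψ.bound
  | ex k φ => k :: φ.bound

def ok : Fml → Bool
  | get k t _ => !k.scratch && t.ok
  | not φ => φ.ok
  | and φ ψ => φ.ok && ψ.ok
  | ex k φ => !k.scratch && decide (k ≠ .inp) && decide (k ∉ φ.bound) && φ.ok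

def code : Fml → Cmd
  | get k t f =>
    .seq t.code <|
    .seq (.forEach .adr (.seq (.pop k) (.ite (fun v => v.1.isSome) (.push .buf Cmd.popped) .skip))) <|
    .seq (.pop k) <|
    .seq (.load fun v => (v.1, f v.1)) <|
    .seq (.ite (fun v => v.1.isSome) (.push k Cmd.popped) .skip) (.move .buf k)
  | not φ => .seq φ.code (.load fun v => (v.1, !v.2))
  | and φ ψ => .seq φ.code (.ite (fun v => v.2) ψ.code .skip)
  | ex k φ =>
    .seq (.copyLen .inp k) <|
    .seq (.load fun v => (v.1, false)) <|
    .forEach k (.seq (.load fun v => (none, v.2)) (.ite (fun v => v.2) .skip φ.code))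

/-- Reading the cell at the address on `adr`. -/
theorem runs_read {k : Stack} (hk : k ≠ .adr) (hk' : k ≠ .buf) (f : Option Sym → Bool) (r : Bool)
    (S : Stacks) (h : S .adr = []) (h' : S .buf = []) (v : ℕ) :
    Runs (.seq (.forEach .adr
        (.seq (.pop k) (.ite (fun v => v.1.isSome) (.push .buf Cmd.popped) .skip))) <|
      .seq (.pop k) <|
      .seq (.load fun v => (v.1, f v.1)) <|
      .seq (.ite (fun v => v.1.isSome) (.push k Cmd.popped) .skip) (.move .buf k))
    (none, r) (update S .adr (List.replicate v none)) (none, f ((S k)[v]?)) S (8 * v + 9) := by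
  have h₁ := Cmd.runs_forEach (k := .adr)
    (c := .seq (.pop k) (.ite (fun v => v.1.isSome) (.push .buf Cmd.popped) .skip)) (T := 3)
    (fun p l => (r, update (update (update S .adr l) k ((S k).drop p.length)) .buf
      ((S k).take p.length).reverse)) (by simp [hk.symm]) (List.replicate v none)
    (fun p x l _ => by
      refine ⟨((S k).drop p.length).head?, ?_⟩
      refine ((Runs.pop k _ _).seq (t₂ := 2) (v₂ := (((S k).drop p.length).head?, r))
        (S₂ := (update (update (update S .adr l) k ((S k).drop (x :: p).length)) .buf
          ((S k).take (x :: p).length).reverse)) ?_).of_eq rfl rfl rfl rfl le_rfl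
      rcases hd : (S k)[p.length]? with _ | y
      -- Past the end of the stack a pop changes nothing, and the address reads as `none`.
      · refine (Runs.iteFalse (v := (none, r)) (t := 1) (by simp) (Runs.load _ _ _)).of_eq
          (by simp [hk, hk', hd]) rfl (by simp [hd]) ?_ le_rfl
        have hl : (S k).length ≤ p.length := by simpa using hd
        rw [List.length_cons, List.take_of_length_le hl, List.take_of_length_le (hl.trans (by omega)),
          List.drop_eq_nil_of_le hl, List.drop_eq_nil_of_le (hl.trans (by omega))]
        funext q
        simp only [Function.update_apply]
        split_ifs <;> simp_all
      · refine (Runs.iteTrue (v := (some y, r)) (t := 1) (by simp) (Runs.push _ _ _ _)).of_eq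
          (by simp [hk, hk', hd]) rfl (by simp [hd]) ?_ le_rfl
        funext q
        simp only [Function.update_apply, Cmd.popped]
        split_ifs <;> simp_all [List.take_add_one]) none
  have h₂ : Runs (.seq (.pop k) <| .seq (.load fun v => (v.1, f v.1)) <|
      .seq (.ite (fun v => v.1.isSome) (.push k Cmd.popped) .skip) (.move .buf k)) (none, r)
      (update (update (update S .adr []) k ((S k).drop v)) .buf ((S k).take v).reverse)
      (none, f ((S k)[v]?)) S (3 * v + 6) := by
    refine ((Runs.pop k _ _).seq <| (Runs.load _ _ _).seq <| (show Runs _ _ _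
      ((S k)[v]?, f ((S k)[v]?)) (update (update S k ((S k).drop v)) .buf
      ((S k).take v).reverse) 2 from ?_).seq
      (Cmd.runs_move hk'.symm ((S k)[v]?) (f ((S k)[v]?)) _)).of_eq rfl rfl rfl ?_ ?_
    · rcases hd : (S k)[v]? with _ | y
      · refine (Runs.iteFalse (v := (none, f none)) (t := 1) (by simp) (Runs.load _ _ _)).of_eq
          (by simp [hk', hd]) rfl rfl ?_ le_rfl
        have hl : (S k).length ≤ v := by simpa using hd
        rw [List.take_of_length_le hl, List.drop_eq_nil_of_le hl]
        funext q
        simp only [Function.update_apply]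
        split_ifs <;> simp_all
      · refine (Runs.iteTrue (v := (some y, f (some y))) (t := 1) (by simp) (Runs.push _ _ _ _)).of_eq
          (by simp [hk', hd]) rfl rfl ?_ le_rfl
        have hl : (S k).drop v = y :: (S k).drop (v + 1) := by
          obtain ⟨hv, rfl⟩ := List.getElem?_eq_some_iff.1 hd
          exact List.drop_eq_getElem_cons hv
        funext q
        simp only [Function.update_apply, Cmd.popped]
        split_ifs <;> simp_all
    · funext q
      simp only [Function.update_apply]
      split_ifs <;> simp_all
    · simp
      omega
  refine ((h₁.of_eq rfl ?_ rfl ?_ le_rfl).seq h₂).of_eq rfl rfl rfl rfl ?_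
  · funext q
    simp only [Function.update_apply]
    split_ifs <;> simp_all
  · simp
  · simp
    omega

/-- Each quantifier is a loop over at most `B` values, so it multiplies the time by about `B`. The
polynomial thus depends on the formula only. The body leaves all stacks as it found them, so the
loop counter, which the body does not quantify over, survives. -/
theorem exists_runs_code (φ : Fml) (hφ : φ.ok) (hi : .inp ∉ φ.bound) : ∃ q : Polynomial ℕ,
    ∀ (B : ℕ) (S : Stacks) (r : Bool), (∀ k, (S k).length ≤ B) → (∀ k, k.scratch → S k = []) →
    (∀ k ∈ φ.bound, S k = []) → Runs φ.code (none, r) S (none, φ.eval S) S (q.eval B) := by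
  induction φ with
  | get k t f =>
    simp only [ok, Bool.and_eq_true] at hφ
    obtain ⟨q, hq⟩ := t.exists_runs_code hφ.2
    have hk : k ≠ .adr := by rintro rfl; exact absurd hφ.1 (by decide)
    have hk' : k ≠ .buf := by rintro rfl; exact absurd hφ.1 (by decide)
    refine ⟨9 * q + 9, fun B S r hB hS _ => ?_⟩
    obtain ⟨h₁, h₂⟩ := hq B 0 S r hB (Nat.zero_le _) hS
    refine (h₂.seq (runs_read hk hk' f r S (hS _ rfl) (hS _ rfl) _)).of_eq rfl ?_ rfl rfl ?_
    · simp [← hS .adr rfl]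
    · simp; omega
  | not φ ih =>
    obtain ⟨q, hq⟩ := ih hφ hi
    refine ⟨q + 1, fun B S r hB hS hb => ?_⟩
    exact ((hq B S r hB hS hb).seq (Runs.load _ _ _)).of_eq rfl rfl rfl rfl (by simp)
  | and φ ψ ih₁ ih₂ =>
    simp only [ok, Bool.and_eq_true] at hφ
    simp only [bound, List.mem_append, not_or] at hi
    obtain ⟨q₁, hq₁⟩ := ih₁ hφ.1 hi.1
    obtain ⟨q₂, hq₂⟩ := ih₂ hφ.2 hi.2
    refine ⟨q₁ + q₂ + 2, fun B S r hB hS hb => ?_⟩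
    have h₁ := hq₁ B S r hB hS fun k hk => hb k (List.mem_append_left _ hk)
    have h₂ := hq₂ B S (φ.eval S) hB hS fun k hk => hb k (List.mem_append_right _ hk)
    cases hv : φ.eval S
    · refine (h₁.seq (Runs.iteFalse hv (Runs.load _ _ _))).of_eq rfl rfl ?_ rfl ?_
      · simp [eval, hv]
      · simp
    · refine (h₁.seq (Runs.iteTrue hv h₂)).of_eq rfl rfl ?_ rfl ?_
      · simp [eval, hv]
      · simp; omega
  | ex k φ ih =>
    simp only [ok, Bool.and_eq_true, decide_eq_true_eq] at hφ
    simp only [bound, List.mem_cons, not_or] at hi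
    obtain ⟨⟨⟨hk, hki⟩, hkφ⟩, hφ⟩ := hφ
    have hk₁ : k ≠ .cnt := by rintro rfl; exact absurd hk (by decide)
    obtain ⟨q, hq⟩ := ih hφ hi.2
    refine ⟨(q + 5) * .X + 7 * .X + 7, fun B S r hB hS hb => ?_⟩
    have hSk : S k = [] := hb k (List.mem_cons_self ..)
    have h₁ := Cmd.runs_forEach (k := k)
      (c := .seq (.load fun v => (none, v.2)) (.ite (fun v => v.2) .skip φ.code))
      (T := q.eval B + 3)
      -- The marks left on `k` are the value being tested, so values are tried in descending order.
      -- The flag records whether one of those tried is a witness, after which the body is skipped.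
      (fun p l => (decide (∃ i < (S .inp).length, l.length ≤ i ∧
        φ.eval (update S k (List.replicate i none)) = true), update S k l)) (by simp)
      (List.replicate (S .inp).length none)
      (fun p x l hl => by
        have hlen : l.length < (S .inp).length := by
          have := congrArg List.length hl
          simp at this
          omega
        have hl' : l = List.replicate l.length none := by
          refine List.eq_replicate_iff.2 ⟨rfl, fun b hb => ?_⟩
          have : b ∈ List.replicate (S .inp).length (none : Sym) := by
            rw [← hl]
            simp [hb]
          exact List.eq_of_mem_replicate this
        refine ⟨none, ((Runs.load _ _ _).seq (t₂ := q.eval B + 2) (S₂ := update S k l) (v₂ := _)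
          ?_).of_eq rfl rfl rfl rfl (by omega)⟩
        have hup : update (update S k (x :: l)) k l = update S k l := by simp
        simp only [hup]
        by_cases hE : ∃ i < (S .inp).length, (x :: l).length ≤ i ∧
          φ.eval (update S k (List.replicate i none)) = true
        · refine (Runs.iteTrue (by simpa using hE) (Runs.load _ _ _)).of_eq rfl rfl ?_ rfl (by omega)
          obtain ⟨i, hi, hle, h⟩ := hE
          have : ∃ i < (S .inp).length, l.length ≤ i ∧
            φ.eval (update S k (List.replicate i none)) = true :=
            ⟨i, hi, by simp at hle; omega, h⟩
          simp only [this, decide_true, id, Prod.mk.injEq, true_and, decide_eq_true_eq]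
          exact ⟨i, hi, hle, h⟩
        · have hrun := hq B (update S k l) false (fun k' => by
            by_cases hk' : k' = k
            · subst hk'
              simp only [Function.update_self]
              exact hlen.le.trans (hB _)
            · rw [Function.update_of_ne hk']; exact hB k') (fun k' hk' => by
            rw [Function.update_of_ne (by rintro rfl; simp [hk'] at hk)]
            exact hS k' hk') (fun k' hk' => by
            rw [Function.update_of_ne (by rintro rfl; exact hkφ hk')]
            exact hb k' (List.mem_cons_of_mem _ hk'))
          refine (Runs.iteFalse rfl hrun).of_eq ?_ rfl ?_ rfl (by omega)
          · simp only [Prod.mk.injEq, true_and]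
            exact (decide_eq_false hE).symm
          · simp only [Prod.mk.injEq, true_and]
            rw [Bool.eq_iff_iff, decide_eq_true_eq]
            constructor
            · intro h
              exact ⟨l.length, hlen, le_rfl, by rw [← hl']; exact h⟩
            · rintro ⟨i, hi, hle, h⟩
              rcases hle.eq_or_lt with rfl | hlt
              · rw [← hl'] at h; exact h
              · exact absurd ⟨i, hi, hlt, h⟩ hE) none
    refine ((Cmd.runs_copyLen (Ne.symm hki) (by decide) hk₁ _ _ _ (hS _ rfl)).seq <|
      (Runs.load _ _ _).seq (h₁.of_eq ?_ ?_ rfl rfl le_rfl)).of_eq rfl rfl ?_ ?_ ?_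
    · simp only [Prod.mk.injEq, true_and, decide_eq_false_iff_not]
      rintro ⟨i, hi, hle, -⟩
      simp at hle
      omega
    · simp [hSk]
    · simp [eval]
    · simp [← hSk]
    · have := hB .inp
      have h3 := Nat.mul_le_mul_left (q.eval B + 5) this
      simp only [List.length_replicate, Polynomial.eval_add, Polynomial.eval_mul, Polynomial.eval_X,
        Polynomial.eval_ofNat]
      rw [show q.eval B + 3 + 2 = q.eval B + 5 from rfl]
      omega

end Fml

/-! ### Iterating a formula on a table -/

/-- The number of cells of the table, for inputs of length `m`. -/
def tableSize (m : ℕ) : ℕ := m ^ 4 + 1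

/-- The first `inc` turns the initial zero into one, which the multiplications raise to `m ^ 4`. -/
def sizeTerm : Term := [.inc, .mul .inp, .mul .inp, .mul .inp, .mul .inp, .inc]

theorem sizeTerm_val (S : Stacks) : sizeTerm.valFrom S 0 = tableSize (S .inp).length := by
  simp [sizeTerm, Term.valFrom, Step.val, tableSize]
  ring

/-- The table computed from the table `d`. -/
def nextTable (g : List Sym → ℕ → Bool) (m : ℕ) (d : List Sym) : List Sym :=
  (List.range (tableSize m)).map fun i => some (g d i)

theorem length_nextTable (g : List Sym → ℕ → Bool) (m : ℕ) (d : List Sym) :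
    (nextTable g m d).length = tableSize m := by simp [nextTable]

namespace Cmd

/-- Put the number of cells of the table on the stack `k`. -/
def putSize (k : Stack) : Cmd := .seq sizeTerm.code (.move .adr k)

/-- Replace the table by the values of `φ` for the addresses given by `idx`. -/
def sweep (φ : Fml) : Cmd :=
  .seq (putSize .idx) <|
  .seq (.forEach .idx <| .seq (.load fun v => (none, v.2)) <| .seq φ.code <|
    .seq (.push .fresh fun v => some v.2) (.load fun _ => (none, false))) <|
  .seq (clear .tab) <| .seq (.move .fresh .buf) (.move .buf .tab)

/-- Iterate `φ` on the table, then evaluate `ψ` and empty the stacks. -/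
def iterate (φ ψ : Fml) : Cmd :=
  .seq (putSize .fuel) <|
  .seq (.forEach .fuel <| .seq (.load fun v => (none, v.2)) (sweep φ)) <|
  .seq ψ.code <| .seq (clear .inp) (clear .tab)

theorem exists_runs_putSize : ∃ q : Polynomial ℕ, ∀ (B : ℕ) (S : Stacks) (r : Bool) (k : Stack),
    k ≠ .adr → (∀ k, (S k).length ≤ B) → (∀ k, k.scratch → S k = []) → S k = [] →
    Runs (putSize k) (none, r) S (none, r)
      (update S k (List.replicate (tableSize (S .inp).length) none)) (q.eval B) := by
  obtain ⟨q, hq⟩ := sizeTerm.exists_runs_code (by decide)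
  refine ⟨4 * q + 2, fun B S r k hk hB hS hSk => ?_⟩
  obtain ⟨h₁, h₂⟩ := hq B 0 S r hB (Nat.zero_le _) hS
  rw [sizeTerm_val] at h₁ h₂
  refine (h₂.seq (runs_move hk.symm _ _ _)).of_eq rfl ?_ rfl ?_ ?_
  · rw [List.replicate_zero, ← hS .adr rfl, Function.update_eq_self]
  · have := hS .adr rfl
    funext q
    simp only [Function.update_apply]
    split_ifs <;> simp_all
  · simp; omega

/-- The new table grows on `fresh` while the old one is still being read. The two moves through
`buf` reverse it twice and so keep its order. -/
theorem exists_runs_sweep (φ : Fml) (hφ : φ.ok)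
    (hb : ∀ k ∈ φ.bound, k ≠ .inp ∧ k ≠ .tab ∧ k ≠ .fuel ∧ k ≠ .fresh ∧ k ≠ .idx) :
    ∃ q : Polynomial ℕ, ∀ (g : List Sym → ℕ → Bool) (w : List Sym),
    (∀ S : Stacks, S .inp = w → φ.eval S = g (S .tab) (S .idx).length) →
    ∀ (B : ℕ) (S : Stacks), S .inp = w → (∀ k, (S k).length ≤ B) → tableSize w.length ≤ B →
    (∀ k, k ≠ .inp → k ≠ .tab → k ≠ .fuel → S k = []) →
    Runs (sweep φ) (none, false) S (none, false) (update S .tab (nextTable g w.length (S .tab)))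
      (q.eval B) := by
  obtain ⟨q₁, hq₁⟩ := exists_runs_putSize
  obtain ⟨q₂, hq₂⟩ := φ.exists_runs_code hφ fun h => (hb _ h).1 rfl
  refine ⟨q₁ + (q₂ + 5) * .X + 9 * .X + 20, fun g w hg B S hw hB hN hS => ?_⟩
  have hsc : ∀ k : Stack, k.scratch → S k = [] := fun k hk =>
    hS k (by rintro rfl; cases hk) (by rintro rfl; cases hk) (by rintro rfl; cases hk)
  have hidx : S .idx = [] := hS _ (by decide) (by decide) (by decide)
  have hfresh : S .fresh = [] := hS _ (by decide) (by decide) (by decide)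
  have hbuf : S .buf = [] := hS _ (by decide) (by decide) (by decide)
  set N := tableSize w.length with hNdef
  have h₁ := hq₁ B S false .idx (by decide) hB hsc hidx
  have h₂ := runs_forEach (k := .idx)
    (c := .seq (.load fun v => (none, v.2)) <| .seq φ.code <|
      .seq (.push .fresh fun v => some v.2) (.load fun _ => (none, false))) (T := q₂.eval B + 3)
    -- Addresses are filled in descending order, the current one being the number of marks left on
    -- `idx`; hence cell 0 ends on top.
    (fun p l => (false, update (update S .idx l) .fresh
      ((List.range' l.length p.length).map fun i => some (g (S .tab) i)))) (by simp)
    (List.replicate N none)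
    (fun p x l hl => by
      have hlen : p.length + (l.length + 1) = N := by simpa using congrArg List.length hl
      refine ⟨none, ?_⟩
      have hrun := hq₂ B (update (update S .idx l) .fresh
        ((List.range' (l.length + 1) p.length).map fun i => some (g (S .tab) i))) false
        (fun k => by
          simp only [Function.update_apply]
          split_ifs
          · simp; omega
          · omega
          · exact hB k)
        (fun k hk => by
          rw [Function.update_of_ne (by rintro rfl; cases hk),
            Function.update_of_ne (by rintro rfl; cases hk)]
          exact hsc k hk)
        (fun k hk => by
          obtain ⟨a, b, c, d, e⟩ := hb k hk
          rw [Function.update_of_ne d, Function.update_of_ne e]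
          exact hS k a b c)
      rw [hg _ (by simpa using hw)] at hrun
      refine ((Runs.load _ _ _).seq ((hrun.of_eq rfl ?_ rfl rfl le_rfl).seq
        ((Runs.push _ _ _ _).seq (Runs.load _ _ _)))).of_eq rfl rfl rfl ?_ (by omega)
      · clear hrun h₁ hq₁ hq₂ hg hb hsc hS hB
        funext q
        simp only [Function.update_apply]
        split_ifs <;> simp_all
      · clear hrun h₁ hq₁ hq₂ hg hb hsc hS hB
        funext q
        simp only [Function.update_apply]
        split_ifs <;> simp_all [List.range'_succ]) none
  have hst : ∀ k, (update (update S .idx []) .fresh (nextTable g w.length (S .tab)) k).length ≤ B := by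
    intro k
    simp only [Function.update_apply]
    split_ifs
    · rw [length_nextTable]; exact hN
    · simp
    · exact hB k
  refine (h₁.seq <| (h₂.of_eq rfl ?_ rfl (S₁' := update (update S .idx []) .fresh
    (nextTable g w.length (S .tab))) ?_ le_rfl).seq <| (runs_clear .tab _ _ _).seq <|
    (runs_move (by decide) _ _ _).seq (runs_move (by decide) _ _ _)).of_eq rfl rfl rfl ?_ ?_
  · rw [hw]
    exact Function.update_eq_self_iff.2 (by simp [hfresh])
  · simp [nextTable, List.range_eq_range', hNdef]
  · clear h₁ h₂ hst hq₁ hq₂ hg hb hsc hS hB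
    funext q
    simp only [Function.update_apply]
    split_ifs <;> simp_all
  · have h5 : (S .tab).length ≤ B := hB _
    have h6 := Nat.mul_le_mul_left (q₂.eval B + 5) hN
    simp [hbuf, length_nextTable]
    rw [← hNdef]
    rw [show q₂.eval B + 3 + 2 = q₂.eval B + 5 from rfl]
    omega

/-- The stacks during the iteration, with input `w`, table `d` and counter `l`. -/
def tableStacks (w d l : List Sym) : Stacks := update (update (initStacks w) .tab d) .fuel l

theorem update_tab_tableStacks (w d l d' : List Sym) :
    update (tableStacks w d l) .tab d' = tableStacks w d' l := by
  rw [tableStacks, Function.update_comm (by decide), Function.update_idem, tableStacks]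

theorem update_fuel_tableStacks (w d l l' : List Sym) :
    update (tableStacks w d l) .fuel l' = tableStacks w d l' := by
  rw [tableStacks, Function.update_idem, tableStacks]

theorem tableStacks_nil (w : List Sym) : tableStacks w [] [] = initStacks w := by
  funext q
  simp only [tableStacks, initStacks, Function.update_apply]
  split_ifs <;> simp_all

theorem clear_tableStacks (w d : List Sym) :
    update (update (tableStacks w d []) .inp []) .tab [] = fun _ => [] := by
  funext q
  simp only [tableStacks, initStacks, Function.update_apply]
  split_ifs <;> simp_all

theorem exists_runs_iterate (φ ψ : Fml) (hφ : φ.ok) (hψ : ψ.ok)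
    (hb : ∀ k ∈ φ.bound, k ≠ .inp ∧ k ≠ .tab ∧ k ≠ .fuel ∧ k ≠ .fresh ∧ k ≠ .idx)
    (hb' : ∀ k ∈ ψ.bound, k ≠ .inp ∧ k ≠ .tab) :
    ∃ q : Polynomial ℕ, ∀ (g : List Sym → ℕ → Bool) (w : List Sym) (ans : Bool),
    (∀ S : Stacks, S .inp = w → φ.eval S = g (S .tab) (S .idx).length) →
    (∀ S : Stacks, S .inp = w →
      S .tab = (nextTable g w.length)^[tableSize w.length] [] → ψ.eval S = ans) →
    Runs (iterate φ ψ) initReg (initStacks w) (none, ans) (fun _ => []) (q.eval w.length) := by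
  obtain ⟨q₁, hq₁⟩ := exists_runs_putSize
  obtain ⟨q₂, hq₂⟩ := exists_runs_sweep φ hφ hb
  obtain ⟨q₃, hq₃⟩ := ψ.exists_runs_code hψ fun h => (hb' _ h).1 rfl
  -- `X ^ 4 + 1 + X` bounds the length of every stack: the table and the counters have at most
  -- `tableSize` symbols, the input has `X`.
  refine ⟨(q₁ + (q₂ + 5) * .X + q₃ + 6 * .X + 20).comp (.X ^ 4 + 1 + .X), fun g w ans hg hans => ?_⟩
  set N := tableSize w.length with hNdef
  set B := w.length ^ 4 + 1 + w.length with hBdef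
  have hNB : N ≤ B := by simp only [hNdef, hBdef, tableSize]; omega
  have hwB : w.length ≤ B := by omega
  have hst_inp : ∀ d l, tableStacks w d l .inp = w := fun d l => by simp [tableStacks, initStacks]
  have hst_tab : ∀ d l, tableStacks w d l .tab = d := fun d l => by simp [tableStacks]
  have hst_fuel : ∀ d l, tableStacks w d l .fuel = l := fun d l => by simp [tableStacks]
  have hst_len : ∀ d l, d.length ≤ N → l.length ≤ N → ∀ k, (tableStacks w d l k).length ≤ B := by
    intro d l hd hl k
    simp only [tableStacks, initStacks, Function.update_apply]
    split_ifs
    · omega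
    · omega
    · exact hwB
    · simp
  have hst_nil : ∀ d l k, k ≠ .inp → k ≠ .tab → k ≠ .fuel → tableStacks w d l k = [] := by
    intro d l k a b c
    simp [tableStacks, initStacks, a, b, c]
  have hdl : ∀ i, ((nextTable g w.length)^[i] []).length ≤ N := by
    intro i
    cases i with
    | zero => simp
    | succ i =>
      rw [Function.iterate_succ_apply', length_nextTable]
  have h₁ := hq₁ B (tableStacks w [] []) false .fuel (by decide) (hst_len _ _ (by simp) (by simp))
    (fun k hk => hst_nil _ _ k (by rintro rfl; cases hk) (by rintro rfl; cases hk)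
      (by rintro rfl; cases hk)) (hst_fuel _ _)
  have h₂ := runs_forEach (k := .fuel) (c := .seq (.load fun v => (none, v.2)) (sweep φ))
    (T := q₂.eval B + 1)
    (fun p l => (false, tableStacks w ((nextTable g w.length)^[p.length] []) l)) (by simp [tableStacks])
    (List.replicate N none)
    (fun p x l hl => by
      have hlen : p.length + (l.length + 1) = N := by simpa using congrArg List.length hl
      refine ⟨none, ?_⟩
      have := hq₂ g w hg B (tableStacks w ((nextTable g w.length)^[p.length] []) l) (hst_inp _ _)
        (hst_len _ _ (hdl _) (by omega)) hNB (hst_nil _ _)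
      refine ((Runs.load _ _ _).seq (this.of_eq rfl ?_ rfl rfl le_rfl)).of_eq rfl rfl rfl ?_
        (by omega)
      · exact (update_fuel_tableStacks ..).symm
      · rw [update_tab_tableStacks, hst_tab, List.length_cons, Function.iterate_succ_apply'])
    none
  have h₃ := hq₃ B (tableStacks w ((nextTable g w.length)^[N] []) []) false
    (hst_len _ _ (hdl _) (by simp)) (fun k hk => hst_nil _ _ k (by rintro rfl; cases hk)
      (by rintro rfl; cases hk) (by rintro rfl; cases hk)) (fun k hk => by
      by_cases hf : k = .fuel
      · rw [hf]; exact hst_fuel _ _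
      · exact hst_nil _ _ k (hb' k hk).1 (hb' k hk).2 hf)
  rw [hans _ (hst_inp _ _) (hst_tab _ _)] at h₃
  refine (h₁.seq <| (h₂.of_eq rfl ?_ rfl ?_ le_rfl).seq <| h₃.seq <|
    (runs_clear .inp _ _ _).seq (runs_clear .tab _ _ _)).of_eq rfl (tableStacks_nil w) rfl
    (clear_tableStacks _ _) ?_
  · rw [update_fuel_tableStacks, hst_inp]; rfl
  · simp
  · have h5 := hdl N
    have h6 := Nat.mul_le_mul_left (q₂.eval B + 5) hNB
    simp [hst_inp, hst_tab, ← hBdef]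
    rw [show q₂.eval B + 1 + 2 = q₂.eval B + 3 from rfl]
    have h7 := Nat.mul_le_mul_right N (show q₂.eval B + 3 ≤ q₂.eval B + 5 by omega)
    omega

end Cmd

/-! ### Two tokens -/

section Tokens

variable {N : Type}

/-- Reachability within `W` from the virtual individual `none`. -/
inductive Reach (step : Option N → N → Prop) (W : Finset N) : Option N → Prop
  | root : Reach step W none
  | step {x y} (h : Reach step W x) (hxy : step x y) (hy : y ∈ W) : Reach step W (some y)

/-- `Pair step w j x z`: two tokens starting at the virtual individual can be moved to `x` and `z`
at cost `j`, where a move to `y`, of one token or of both together, costs `w y`. -/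
inductive Pair (step : Option N → N → Prop) (w : N → ℕ) : ℕ → Option N → Option N → Prop
  | root : Pair step w 0 none none
  | both {j x y} (h : Pair step w j x x) (hxy : step x y) : Pair step w (j + w y) (some y) (some y)
  | left {j x y z} (h : Pair step w j x z) (hxy : step x y) : Pair step w (j + w y) (some y) z
  | swap {j x z} (h : Pair step w j x z) : Pair step w j z x

variable {step : Option N → N → Prop} {w : N → ℕ}

theorem Reach.mono {W W' : Finset N} (hW : W ⊆ W') {x : Option N} (h : Reach step W x) :
    Reach step W' x := by
  induction h with
  | root => exact .root
  | step _ hxy hy ih => exact .step ih hxy (hW hy)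

theorem Reach.mem {W : Finset N} {y : N} (h : Reach step W (some y)) : y ∈ W := by
  cases h; assumption

variable [DecidableEq N]

/-- Cut a walk to `y` at its first visit to `y`. -/
theorem Reach.exists_last {W : Finset N} {y : N} (h : Reach step W (some y)) :
    ∃ x, Reach step (W.erase y) x ∧ step x y := by
  have key : ∀ v, Reach step W v →
      Reach step (W.erase y) v ∨ ∃ x, Reach step (W.erase y) x ∧ step x y := by
    intro v hv
    induction hv with
    | root => exact .inl .root
    | @step x y' _ hxy hy ih =>
      rcases ih with ih | ih
      · by_cases hyy : y' = y
        · exact .inr ⟨x, ih, hyy ▸ hxy⟩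
        · exact .inl (.step ih hxy (Finset.mem_erase.2 ⟨hyy, hy⟩))
      · exact .inr ih
  rcases key _ h with h | h
  · exact absurd h.mem (Finset.notMem_erase _ _)
  · exact h

/-- One of two reachable individuals is reachable without the other. -/
theorem Reach.erase_or_erase {W : Finset N} {a b : N} (hab : a ≠ b) (ha : Reach step W (some a)) :
    Reach step (W.erase b) (some a) ∨ Reach step (W.erase a) (some b) := by
  -- Along a walk to `a`, whichever of `a` and `b` is met first is reached without the other.
  have key : ∀ v, Reach step W v → Reach step ((W.erase a).erase b) v ∨
      (Reach step (W.erase b) (some a) ∨ Reach step (W.erase a) (some b)) := by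
    intro v hv
    induction hv with
    | root => exact .inl .root
    | @step x y _ hxy hy ih =>
      rcases ih with ih | ih
      · by_cases h₁ : y = a
        · subst h₁
          refine .inr (.inl (.step (ih.mono ?_) hxy (Finset.mem_erase.2 ⟨hab, hy⟩)))
          exact Finset.erase_subset_erase _ (Finset.erase_subset _ _)
        · by_cases h₂ : y = b
          · subst h₂
            exact .inr (.inr (.step (ih.mono (Finset.erase_subset _ _)) hxy
              (Finset.mem_erase.2 ⟨hab.symm, hy⟩)))
          · exact .inl (.step ih hxy (by simp [h₁, h₂, hy]))
      · exact .inr ih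
  rcases key _ ha with h | h
  · exact absurd h.mem (by simp)
  · exact h

/-- Two individuals reachable within `W` can be reached by tokens at the cost of `W`. -/
theorem Pair.of_reach (n : ℕ) : ∀ {W : Finset N}, W.card ≤ n → ∀ {x z : Option N},
    Reach step W x → Reach step W z → ∃ j ≤ ∑ y ∈ W, w y, Pair step w j x z := by
  induction n with
  | zero =>
    intro W hW x z hx hz
    have hW' : W = ∅ := Finset.card_eq_zero.1 (Nat.le_zero.1 hW)
    subst hW'
    cases hx with
    | step _ _ hy => exact absurd hy (Finset.notMem_empty _)
    | root =>
      cases hz with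
      | step _ _ hy => exact absurd hy (Finset.notMem_empty _)
      | root => exact ⟨0, Nat.zero_le _, .root⟩
  | succ n ih =>
    intro W hW
    have hsum : ∀ y ∈ W, ∑ v ∈ W.erase y, w v + w y = ∑ v ∈ W, w v :=
      fun y hy => Finset.sum_erase_add _ _ hy
    have hcard : ∀ y ∈ W, (W.erase y).card ≤ n := fun y hy => by
      rw [Finset.card_erase_of_mem hy]; omega
    -- If `z` does not need `y`, the move to `y` can be made last: by induction the tokens get to a
    -- predecessor of `y` and to `z` at the cost of `W` without `y`, and `y` is then paid for once.
    have aux : ∀ {y : N} {z : Option N}, Reach step W (some y) → Reach step (W.erase y) z →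
        ∃ j ≤ ∑ y ∈ W, w y, Pair step w j (some y) z := by
      intro y z hy hz
      obtain ⟨x, hx, hxy⟩ := hy.exists_last
      obtain ⟨j, hj, hp⟩ := ih (hcard y hy.mem) hx hz
      exact ⟨_, by rw [← hsum y hy.mem]; omega, hp.left hxy⟩
    have aux' : ∀ {y : N} {z : Option N}, Reach step W (some y) → Reach step (W.erase y) z →
        ∃ j ≤ ∑ y ∈ W, w y, Pair step w j z (some y) := by
      intro y z hy hz
      obtain ⟨j, hj, hp⟩ := aux hy hz
      exact ⟨j, hj, hp.swap⟩
    intro x z hx hz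
    rcases x with _ | x
    · rcases z with _ | z
      · exact ⟨0, Nat.zero_le _, .root⟩
      · exact aux' hz .root
    · rcases z with _ | z
      · exact aux hx .root
      -- With equal targets the tokens make the last step together, so that the target is paid for
      -- only once.
      · by_cases hxz : x = z
        · subst hxz
          obtain ⟨y, hy, hyx⟩ := hx.exists_last
          obtain ⟨j, hj, hp⟩ := ih (hcard x hx.mem) hy hy
          exact ⟨_, by rw [← hsum x hx.mem]; omega, hp.both hyx⟩
        · rcases hx.erase_or_erase hxz with h | h
          · exact aux' hz h
          · exact aux hx h

/-- Tokens moved at cost `j`, where only the individuals outside `T` cost anything, visit at most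
`j` individuals outside `T`. -/
theorem Pair.exists_reach {T : Finset N} {P : N → Prop} (hP : ∀ x y, step x y → P y) {j : ℕ}
    {x z : Option N} (h : Pair step (fun y => if y ∈ T then 0 else 1) j x z) :
    ∃ U : Finset N, Disjoint U T ∧ U.card ≤ j ∧ (∀ u ∈ U, P u) ∧
      Reach step (T ∪ U) x ∧ Reach step (T ∪ U) z := by
  -- `U` collects the visited individuals outside `T`. Repeated visits may be paid for repeatedly,
  -- whence only an inequality for its size.
  have ext : ∀ {U : Finset N} {j : ℕ} {x y}, Disjoint U T → U.card ≤ j → (∀ u ∈ U, P u) →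
      step x y → ∃ U' : Finset N, U ⊆ U' ∧ Disjoint U' T ∧
        U'.card ≤ j + (if y ∈ T then 0 else 1) ∧ (∀ u ∈ U', P u) ∧ y ∈ T ∪ U' := by
    intro U j x y hd hc hU hxy
    by_cases hy : y ∈ T
    · exact ⟨U, subset_rfl, hd, by simpa [hy] using hc, hU, Finset.mem_union_left _ hy⟩
    · refine ⟨insert y U, Finset.subset_insert _ _, ?_, ?_, ?_, by simp⟩
      · exact Finset.disjoint_insert_left.2 ⟨hy, hd⟩
      · have := Finset.card_insert_le y U
        simp only [hy, if_false]
        omega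
      · intro u hu
        rcases Finset.mem_insert.1 hu with rfl | hu
        · exact hP _ _ hxy
        · exact hU u hu
  induction h with
  | root => exact ⟨∅, by simp, by simp, by simp, .root, .root⟩
  | both _ hxy ih =>
    obtain ⟨U, h₁, h₂, h₃, h₄, -⟩ := ih
    obtain ⟨U', h, h₁', h₂', h₃', hy⟩ := ext h₁ h₂ h₃ hxy
    have hr := Reach.step (h₄.mono (Finset.union_subset_union_right h)) hxy hy
    exact ⟨U', h₁', h₂', h₃', hr, hr⟩
  | left _ hxy ih =>
    obtain ⟨U, h₁, h₂, h₃, h₄, h₅⟩ := ih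
    obtain ⟨U', h, h₁', h₂', h₃', hy⟩ := ext h₁ h₂ h₃ hxy
    exact ⟨U', h₁', h₂', h₃', .step (h₄.mono (Finset.union_subset_union_right h)) hxy hy,
      h₅.mono (Finset.union_subset_union_right h)⟩
  | swap _ ih =>
    obtain ⟨U, h₁, h₂, h₃, h₄, h₅⟩ := ih
    exact ⟨U, h₁, h₂, h₃, h₅, h₄⟩

end Tokens

/-! ### Helly's theorem on the line -/

/-- In a profile that is DQC, a set qualified by a set `K` is qualified by two members of `K`. -/
theorem IsDQC.exists_pair {N : Type} [Fintype N] {φ : Profile N} (hφ : IsDQC φ)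
    {K S : Set N} (hK : K.Nonempty) (h : ∀ s ∈ S, ∃ a ∈ K, φ a s = true) :
    ∃ a ∈ K, ∃ b ∈ K, ∀ s ∈ S, φ a s = true ∨ φ b s = true := by
  classical
  obtain ⟨e, he⟩ := hφ
  by_contra! hc
  -- The failure of the pair `a, a` shows that `a` disqualifies a member of `S`; take the first
  -- position of such a member.
  have hne : ∀ a ∈ K, ∃ x, e x ∈ S ∧ φ a (e x) = false ∧
      ∀ y, e y ∈ S → φ a (e y) = false → x ≤ y := by
    intro a ha
    obtain ⟨s, hs, h₁, -⟩ := hc a ha a ha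
    have hfin : (Finset.univ.filter fun x => e x ∈ S ∧ φ a (e x) = false).Nonempty :=
      ⟨e.symm s, by simpa using ⟨hs, Bool.eq_false_of_not_eq_true h₁⟩⟩
    obtain ⟨x, hx, hmin⟩ := Finset.exists_min_image _ id hfin
    simp only [Finset.mem_filter, Finset.mem_univ, true_and, id] at hx hmin
    exact ⟨x, hx.1, hx.2, fun y h₁ h₂ => hmin y ⟨h₁, h₂⟩⟩
  choose! l hlS hl hmin using hne
  -- For `a` with the largest first position `l a`, some `b` qualifies the individual there. But `b`
  -- disqualifies those at `l b ≤ l a` and at the position of some `s` disqualified by both, which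
  -- is at least `l a`; this contradicts consecutiveness.
  obtain ⟨a, ha, hmax⟩ := Set.exists_max_image K l K.toFinite hK
  obtain ⟨b, hb, hbl⟩ := h _ (hlS a ha)
  obtain ⟨s, hs, h₁, h₂⟩ := hc a ha b hb
  replace h₁ := Bool.eq_false_of_not_eq_true h₁
  replace h₂ := Bool.eq_false_of_not_eq_true h₂
  have h₃ : l a ≤ e.symm s := hmin a ha _ (by simpa using hs) (by simpa using h₁)
  have := (he b).out (x := l b) (y := e.symm s) (hl b hb) (by simpa using h₂) ⟨hmax b hb, h₃⟩
  rw [Set.mem_ofPred_eq, hbl] at this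
  cases this

/-! ### The two rules by reachability -/

section Rules

variable {N : Type}

theorem subset_limitStage [DecidableEq N] (φ : Profile N) {T K₀ : Finset N} (h : K₀ ⊆ T) :
    K₀ ⊆ limitStage φ h := by
  have : ∀ ℓ, K₀ ⊆ stage φ T K₀ ℓ := by
    intro ℓ
    induction ℓ with
    | zero => exact subset_rfl
    | succ ℓ ih => exact ih.trans Finset.subset_union_left
  exact this _

theorem mem_limitStage_of_qualified [DecidableEq N] (φ : Profile N) {T K₀ : Finset N} (h : K₀ ⊆ T) {a x : N}
    (ha : a ∈ limitStage φ h) (hx : x ∈ T) (hax : φ a x = true) : x ∈ limitStage φ h := by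
  have := Nat.find_spec (stage_stabilizes φ h)
  rw [limitStage, ← this]
  exact Finset.mem_union_right _ (Finset.mem_filter.2 ⟨hx, a, ha, hax⟩)

theorem limitStage_induction [DecidableEq N] (φ : Profile N) {T K₀ : Finset N} (h : K₀ ⊆ T) {P : N → Prop}
    (h₀ : ∀ x ∈ K₀, P x) (hs : ∀ a x, P a → x ∈ T → φ a x = true → P x) {x : N}
    (hx : x ∈ limitStage φ h) : P x := by
  have : ∀ ℓ, ∀ x ∈ stage φ T K₀ ℓ, P x := by
    intro ℓ
    induction ℓ with
    | zero => exact h₀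
    | succ ℓ ih =>
      intro x hx
      rcases Finset.mem_union.1 hx with hx | hx
      · exact ih x hx
      · obtain ⟨hx, a, ha, hax⟩ := Finset.mem_filter.1 hx
        exact hs a x (ih a ha) hx hax
  exact this _ x hx

/-- The individuals that may take part when `c` is chosen: for the consensus-start-respecting rule
(`lib = false`), where `c` is to be in the initial set, they have to qualify `c`. -/
def allowed (lib : Bool) (φ : Profile N) (c x : N) : Prop := lib = true ∨ φ x c = true

/-- The individuals in the initial set when `c` is chosen. -/
def source (lib : Bool) (φ : Profile N) (c x : N) : Prop :=
  if lib = true then φ x x = true else x = c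

/-- The moves of a token when `c` is chosen. -/
def tokenMove (lib : Bool) (φ : Profile N) (c : N) (x : Option N) (y : N) : Prop :=
  -- An initial individual may be entered from any position; as the root is always reachable, this
  -- does not enlarge the reachable set.
  allowed lib φ c y ∧ (source lib φ c y ∨ ∃ a, x = some a ∧ φ a y = true)

/-- The rule in question. -/
def rule (lib : Bool) : SocialAggregationRule := if lib = true then lsr else csr

variable {lib : Bool} {φ : Profile N}

/-- A reachable individual is qualified by a reachable one. -/
theorem exists_qualified_of_reach {W : Finset N} {c : N} {x : N}
    (h : Reach (tokenMove lib φ c) W (some x)) :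
    ∃ a, Reach (tokenMove lib φ c) W (some a) ∧ φ a x = true := by
  have h' := h
  cases h' with
  | @step v _ hv hxy hy =>
    -- Initial individuals qualify themselves: by definition for the liberal rule, and for the
    -- consensus rule because `c` itself must be allowed.
    rcases hxy.2 with hs | ⟨a, rfl, hax⟩
    · refine ⟨x, h, ?_⟩
      cases lib
      · have hxc : x = c := by simpa [source] using hs
        simpa [allowed, hxc] using hxy.1
      · simpa [source] using hs
    · exact ⟨a, hv, hax⟩

variable [DecidableEq N]

/-- For the consensus rule, `hW` is what puts `c` into the initial set once `c` is in `W`. -/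
theorem mem_select_of_reach {W : Finset N} {c : N} (hW : ∀ x ∈ W, allowed lib φ c x) {x : N}
    (h : Reach (tokenMove lib φ c) W (some x)) : x ∈ (rule lib).select φ W := by
  have key : ∀ v, Reach (tokenMove lib φ c) W v → ∀ x, v = some x → x ∈ (rule lib).select φ W := by
    intro v hv
    induction hv with
    | root => simp
    | @step v y hv hxy hy ih =>
      rintro _ ⟨⟩
      rcases hxy.2 with hs | ⟨a, rfl, hay⟩
      · cases lib
        · refine subset_limitStage φ (Finset.filter_subset _ _) ?_
          refine Finset.mem_filter.2 ⟨hy, fun b hb => ?_⟩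
          have hyc : y = c := by simpa [source] using hs
          simpa [allowed, hyc] using hW b hb
        · refine subset_limitStage φ (Finset.filter_subset _ _) ?_
          exact Finset.mem_filter.2 ⟨hy, by simpa [source] using hs⟩
      · have ha := ih a rfl
        cases lib
        · exact mem_limitStage_of_qualified φ (Finset.filter_subset _ _) ha hy hay
        · exact mem_limitStage_of_qualified φ (Finset.filter_subset _ _) ha hy hay
  exact key _ h x rfl

/-- For the consensus rule `c` is any member of the initial set, which is nonempty since otherwise
nobody would be selected. The other initial individuals need not be sources: `c` qualifies them, as
everybody in `W` does. For the liberal rule any `c` will do. -/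
theorem exists_reach_of_subset_select {W S : Finset N} (hS : S.Nonempty)
    (h : S ⊆ (rule lib).select φ W) : ∃ c, (∀ x ∈ W, allowed lib φ c x) ∧
      ∀ s ∈ S, Reach (tokenMove lib φ c) W (some s) := by
  cases lib
  · obtain ⟨c, hc⟩ : (consensusStart φ W).Nonempty := by
      by_contra hne
      rw [Finset.not_nonempty_iff_eq_empty] at hne
      obtain ⟨s, hs⟩ := hS
      refine limitStage_induction φ (Finset.filter_subset _ _) (P := fun _ => False) ?_ ?_ (h hs)
      · intro x hx
        change x ∈ consensusStart φ W at hx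
        simp [hne] at hx
      · simp
    obtain ⟨hcW, hc⟩ := Finset.mem_filter.1 hc
    have hall : ∀ x ∈ W, allowed false φ c x := fun x hx => .inr (hc x hx)
    have hcr : Reach (tokenMove false φ c) W (some c) :=
      .step .root ⟨hall c hcW, .inl (by simp [source])⟩ hcW
    refine ⟨c, hall, fun s hs => limitStage_induction φ (Finset.filter_subset _ _)
      (P := fun x => Reach (tokenMove false φ c) W (some x)) ?_ ?_ (h hs)⟩
    · intro x hx
      obtain ⟨hxW, hx⟩ := Finset.mem_filter.1 hx
      exact .step hcr ⟨hall x hxW, .inr ⟨c, rfl, hx c hcW⟩⟩ hxW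
    · intro a x ha hx hax
      exact .step ha ⟨hall x hx, .inr ⟨a, rfl, hax⟩⟩ hx
  · obtain ⟨c, hc⟩ := hS
    refine ⟨c, fun _ _ => .inl rfl, fun s hs => limitStage_induction φ (Finset.filter_subset _ _)
      (P := fun x => Reach (tokenMove true φ c) W (some x)) ?_ ?_ (h hs)⟩
    · intro x hx
      obtain ⟨hxW, hx⟩ := Finset.mem_filter.1 hx
      exact .step .root ⟨.inl rfl, .inl (by simpa [source] using hx)⟩ hxW
    · intro a x ha hx hax
      exact .step ha ⟨.inl rfl, .inr ⟨a, rfl, hax⟩⟩ hx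

end Rules

/-- For profiles that are DQC, the question of GCAI in terms of tokens. -/
theorem Instance.isYes_iff (lib : Bool) (I : Instance) (hI : IsDQC I.φ) {L : ℕ} (hL : I.n < L) :
    I.IsYes (rule lib) ↔ ∃ c, (∀ t ∈ I.T, allowed lib I.φ c t) ∧ ∃ j < L, (j : ℤ) ≤ I.k ∧
      ∃ a b, Pair (tokenMove lib I.φ c) (fun y => if y ∈ I.T then 0 else 1) j (some a) (some b) ∧
        ∀ s ∈ I.S, I.φ a s = true ∨ I.φ b s = true := by
  constructor
  · rintro ⟨U, hU, hk, hS⟩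
    obtain ⟨c, hc, hr⟩ := exists_reach_of_subset_select I.S_nonempty hS
    obtain ⟨s₀, hs₀⟩ := I.S_nonempty
    obtain ⟨a, ha, b, hb, hab⟩ := hI.exists_pair
      (K := {x | Reach (tokenMove lib I.φ c) (I.T ∪ U) (some x)}) (S := (I.S : Set (Fin I.n)))
      ⟨s₀, hr s₀ hs₀⟩ (fun s hs => by
        obtain ⟨a, ha, has⟩ := exists_qualified_of_reach (hr s hs)
        exact ⟨a, ha, has⟩)
    obtain ⟨j, hj, hp⟩ := Pair.of_reach (w := fun y => if y ∈ I.T then 0 else 1) _ le_rfl ha hb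
    -- Only the individuals of `U` carry a cost.
    have hsum : ∑ y ∈ I.T ∪ U, (if y ∈ I.T then 0 else 1) ≤ U.card := by
      rw [Finset.sum_ite, Finset.sum_const_zero, zero_add, Finset.sum_const, smul_eq_mul, mul_one]
      refine Finset.card_le_card fun x hx => ?_
      simp only [Finset.mem_filter, Finset.mem_union] at hx
      tauto
    refine ⟨c, fun t ht => hc t (Finset.mem_union_left _ ht), j, ?_, ?_, a, b, hp,
      fun s hs => hab s hs⟩
    -- The cost is at most `n`, however large the binary number `k` is; this keeps the table
    -- polynomial.
    · have := (Finset.card_le_univ U).trans_eq (Fintype.card_fin _)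
      exact (hj.trans (hsum.trans this)).trans_lt hL
    · exact le_trans (by exact_mod_cast hj.trans hsum) hk
  · rintro ⟨c, hT, j, -, hk, a, b, hp, hS⟩
    obtain ⟨U, hd, hc, hU, ha, hb⟩ := hp.exists_reach (P := allowed lib I.φ c) fun _ _ h => h.1
    have hW : ∀ x ∈ I.T ∪ U, allowed lib I.φ c x := fun x hx =>
      (Finset.mem_union.1 hx).elim (hT x) (hU x)
    refine ⟨U, fun u hu => ?_, le_trans (by exact_mod_cast hc) hk, fun s hs => ?_⟩
    · exact Finset.mem_sdiff.2 ⟨Finset.mem_univ _, Finset.disjoint_left.1 hd hu⟩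
    · have hsW : s ∈ I.T ∪ U := Finset.mem_union_left _ (I.S_subset_T hs)
      -- As `s` lies in `T`, it is one further free move away from `a` or `b`.
      refine mem_select_of_reach hW ?_
      rcases hS s hs with h | h
      · exact .step ha ⟨hW s hsW, .inr ⟨a, rfl, h⟩⟩ hsW
      · exact .step hb ⟨hW s hsW, .inr ⟨b, rfl, h⟩⟩ hsW

/-! ### Reading the encoding of an instance -/

theorem getElem?_flatten_append {α : Type} {m : ℕ} (t : List α) {b : ℕ} (hb : b < m) :
    ∀ {rows : List (List α)}, (∀ r ∈ rows, r.length = m) → ∀ {a : ℕ} {r : List α},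
      rows[a]? = some r → (rows.flatten ++ t)[a * m + b]? = r[b]?
  | [], _, a, r, h => by simp at h
  | r' :: rows, hr, 0, r, h => by
    obtain rfl : r' = r := by simpa using h
    have := hr r' (by simp)
    rw [List.flatten_cons, List.append_assoc, List.getElem?_append_left (by omega)]
    simp
  | r' :: rows, hr, a + 1, r, h => by
    have h₁ := hr r' (by simp)
    rw [List.flatten_cons, List.append_assoc, List.getElem?_append_right (by rw [h₁]; nlinarith),
      h₁, show (a + 1) * m + b - m = a * m + b by rw [Nat.add_mul]; omega]
    exact getElem?_flatten_append t hb (fun r hr' => hr r (List.mem_cons_of_mem _ hr'))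
      (by simpa using h)

theorem length_flatten_of_forall {α : Type} {m : ℕ} {rows : List (List α)}
    (h : ∀ r ∈ rows, r.length = m) : rows.flatten.length = rows.length * m := by
  rw [List.length_flatten, List.map_congr_left h]
  simp

theorem length_encodeVec {n : ℕ} (v : Fin n → Bool) : (encodeVec v).length = n + 1 := by
  simp [encodeVec]

theorem getElem?_encodeVec {n : ℕ} (v : Fin n → Bool) (i : Fin n) :
    (encodeVec v)[(i : ℕ)]? = some (some (v i)) := by
  rw [encodeVec, List.getElem?_append_left (by simp)]
  simp

theorem getElem?_encodeVec_length {n : ℕ} (v : Fin n → Bool) : (encodeVec v)[n]? = some none := by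
  rw [encodeVec, List.getElem?_append_right (by simp)]
  simp

namespace Instance

variable (I : Instance)

/-- The `0`-`1` vectors in the encoding. -/
def rows : List (List Sym) :=
  (List.finRange I.n).map (fun a => encodeVec (I.φ a)) ++
    [encodeVec (fun a => decide (a ∈ I.S)), encodeVec (fun a => decide (a ∈ I.T))]

theorem encode_eq : I.encode = I.rows.flatten ++ encodeInt I.k := by
  simp [encode, rows, List.flatMap]

theorem length_of_mem_rows : ∀ r ∈ I.rows, r.length = I.n + 1 := by
  intro r hr
  simp only [rows, List.mem_append, List.mem_map, List.mem_cons, List.not_mem_nil, or_false] at hr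
  rcases hr with ⟨a, -, rfl⟩ | rfl | rfl <;> exact length_encodeVec _

theorem length_rows : I.rows.length = I.n + 2 := by simp [rows]

theorem encode_row {a b : ℕ} {r : List Sym} (hb : b < I.n + 1) (hr : I.rows[a]? = some r) :
    I.encode[a * (I.n + 1) + b]? = r[b]? := by
  rw [encode_eq]
  exact getElem?_flatten_append _ hb I.length_of_mem_rows hr

theorem rows_profile (a : Fin I.n) : I.rows[(a : ℕ)]? = some (encodeVec (I.φ a)) := by
  rw [rows, List.getElem?_append_left (by simp)]
  simp

theorem rows_S : I.rows[I.n]? = some (encodeVec fun a => decide (a ∈ I.S)) := by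
  rw [rows, List.getElem?_append_right (by simp)]
  simp

theorem rows_T : I.rows[I.n + 1]? = some (encodeVec fun a => decide (a ∈ I.T)) := by
  rw [rows, List.getElem?_append_right (by simp)]
  simp

theorem encode_tail (i : ℕ) :
    I.encode[(I.n + 2) * (I.n + 1) + i]? = (encodeInt I.k)[i]? := by
  have h := length_flatten_of_forall I.length_of_mem_rows
  rw [length_rows] at h
  rw [encode_eq, List.getElem?_append_right (by omega), h]
  simp

theorem length_encode : I.encode.length =
    (I.n + 2) * (I.n + 1) + (1 + (Computability.encodeNat I.k.natAbs).length) := by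
  rw [encode_eq, List.length_append, length_flatten_of_forall I.length_of_mem_rows, length_rows]
  simp [encodeInt]
  omega

theorem n_pos : 0 < I.n := by
  obtain ⟨s, -⟩ := I.S_nonempty
  exact s.pos

/-- Makes `n`, the code of the virtual individual, available to quantifiers bounded by the input
length. -/
theorem n_lt_length : I.n < I.encode.length := by
  rw [length_encode]
  nlinarith

end Instance

/-! ### Binary numbers -/

/-- The number with the given binary digits, the least significant one first. -/
def bitsVal : List Bool → ℕ
  | [] => 0
  | b :: l => b.toNat + 2 * bitsVal l

theorem bitsVal_encodePosNum : ∀ p : PosNum, bitsVal (Computability.encodePosNum p) = p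
  | .one => rfl
  | .bit0 p => by
    simp [Computability.encodePosNum, bitsVal, bitsVal_encodePosNum p, PosNum.cast_bit0]
    omega
  | .bit1 p => by
    simp [Computability.encodePosNum, bitsVal, bitsVal_encodePosNum p, PosNum.cast_bit1]
    omega

theorem bitsVal_encodeNat (m : ℕ) : bitsVal (Computability.encodeNat m) = m := by
  rw [Computability.encodeNat]
  have h : bitsVal (Computability.encodeNum (m : Num)) = ((m : Num) : ℕ) := by
    cases (m : Num) with
    | zero => rfl
    | pos p => exact bitsVal_encodePosNum p
  rw [h, Num.to_of_nat]

/-- Missing digits count as zeros, so the recursion has no boundary case. -/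
theorem bitsVal_drop (l : List Bool) (i : ℕ) : bitsVal (l.drop i) =
    (if l[i]? = some true then 1 else 0) + 2 * bitsVal (l.drop (i + 1)) := by
  rcases h : l[i]? with _ | b
  · have : l.length ≤ i := by simpa using h
    rw [List.drop_eq_nil_of_le this, List.drop_eq_nil_of_le (by omega)]
    simp [bitsVal]
  · obtain ⟨hi, rfl⟩ := List.getElem?_eq_some_iff.1 h
    rw [List.drop_eq_getElem_cons hi, bitsVal]
    cases l[i] <;> simp

namespace Instance

variable (I : Instance)

/-- The number obtained from `|k|` by deleting the last `i` binary digits. -/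
def budget (i : ℕ) : ℕ := bitsVal ((Computability.encodeNat I.k.natAbs).drop i)

theorem budget_zero : I.budget 0 = I.k.natAbs := by simp [budget, bitsVal_encodeNat]

/-! ### Cells of the input -/

/-- The cell of the input at the address `i` holds a one. -/
def one (i : ℕ) : Prop := I.encode[i]? = some (some true)

/-- Rows have length `n + 1`, including the separator. Here and below the address is written as the
left-to-right evaluation of a `Term` produces it. -/
theorem one_profile (a b : Fin I.n) : I.one (a * I.n + a + b) ↔ I.φ a b = true := by
  rw [one, show (a : ℕ) * I.n + a + b = a * (I.n + 1) + b by ring,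
    I.encode_row (by omega) (I.rows_profile a), getElem?_encodeVec]
  simp

theorem one_S (s : Fin I.n) : I.one (I.n * I.n + I.n + s) ↔ s ∈ I.S := by
  rw [one, show I.n * I.n + I.n + s = I.n * (I.n + 1) + s by ring,
    I.encode_row (by omega) I.rows_S, getElem?_encodeVec]
  simp

theorem one_T (t : Fin I.n) : I.one ((I.n + 1) * I.n + I.n + 1 + t) ↔ t ∈ I.T := by
  rw [one, show (I.n + 1) * I.n + I.n + 1 + t = (I.n + 1) * (I.n + 1) + t by ring,
    I.encode_row (by omega) I.rows_T, getElem?_encodeVec]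
  simp

theorem one_sign : I.one ((I.n + 1 + 1) * I.n + I.n + 1 + 1) ↔ I.k < 0 := by
  rw [one, show (I.n + 1 + 1) * I.n + I.n + 1 + 1 = (I.n + 2) * (I.n + 1) + 0 by ring,
    I.encode_tail]
  simp [encodeInt]

theorem budget_eq (i : ℕ) : I.budget i =
    (if I.encode[(I.n + 1 + 1) * I.n + I.n + 1 + 1 + 1 + i]? = some (some true) then 1 else 0) +
      2 * I.budget (i + 1) := by
  rw [show (I.n + 1 + 1) * I.n + I.n + 1 + 1 + 1 + i = (I.n + 2) * (I.n + 1) + (i + 1) by ring,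
    I.encode_tail, budget, bitsVal_drop]
  simp [encodeInt, budget]

theorem budget_length {i : ℕ} (h : I.encode.length ≤ i + 1) : I.budget i = 0 := by
  rw [length_encode] at h
  rw [budget, List.drop_eq_nil_of_le (by nlinarith [I.n_pos])]
  rfl

/-- The number of individuals is the position of the first separator. -/
theorem eq_n_iff (m : ℕ) : (I.encode[m]? = some none ∧ ∀ i < m, I.encode[i]? ≠ some none) ↔
    m = I.n := by
  have hn : I.encode[I.n]? = some none := by
    have := I.encode_row (a := 0) (b := I.n) (by omega) (I.rows_profile ⟨0, I.n_pos⟩)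
    rw [zero_mul, zero_add] at this
    rw [this, getElem?_encodeVec_length]
  have hlt : ∀ i < I.n, I.encode[i]? ≠ some none := by
    intro i hi
    have := I.encode_row (a := 0) (b := i) (by omega) (I.rows_profile ⟨0, I.n_pos⟩)
    rw [zero_mul, zero_add] at this
    rw [this, getElem?_encodeVec _ ⟨i, hi⟩]
    simp
  constructor
  · rintro ⟨h₁, h₂⟩
    rcases lt_trichotomy m I.n with h | h | h
    · exact absurd h₁ (hlt m h)
    · exact h
    · exact absurd hn (h₂ _ h)
  · rintro rfl
    exact ⟨hn, hlt⟩

end Instance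

/-! ### Saturation -/

/-- The cell of the table `d` at the address `i` holds a one. -/
def Cell (d : List Sym) (i : ℕ) : Prop := d[i]? = some (some true)

theorem cell_nextTable {g : List Sym → ℕ → Bool} {m : ℕ} {d : List Sym} {i : ℕ} :
    Cell (nextTable g m d) i ↔ i < tableSize m ∧ g d i = true := by
  unfold Cell nextTable
  rw [List.getElem?_map]
  by_cases h : i < tableSize m
  · rw [List.getElem?_range h]
    simp [h]
  · rw [List.getElem?_eq_none (by simpa using h)]
    simp [h]

/-- If `g` is monotone, the iteration has reached a fixed point after as many steps as there are
cells. -/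
theorem cell_iterate_of_eval {g : List Sym → ℕ → Bool} {m : ℕ}
    (hg : ∀ d d' i, (∀ i, Cell d i → Cell d' i) → g d i = true → g d' i = true) {i : ℕ}
    (hi : i < tableSize m) (h : g ((nextTable g m)^[tableSize m] []) i = true) :
    Cell ((nextTable g m)^[tableSize m] []) i := by
  classical
  set N := tableSize m
  let d : ℕ → List Sym := fun r => (nextTable g m)^[r] []
  have hd : ∀ r i, Cell (d (r + 1)) i ↔ i < N ∧ g (d r) i = true := fun r i => by
    simp only [d, Function.iterate_succ_apply']
    exact cell_nextTable
  have hlt : ∀ r i, Cell (d r) i → i < N := by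
    intro r i h
    cases r with
    | zero => simp [d, Cell] at h
    | succ r => exact ((hd r i).1 h).1
  -- The iteration starts from the empty table, so monotonicity of `g` makes it increasing.
  have hmono : ∀ r i, Cell (d r) i → Cell (d (r + 1)) i := by
    intro r
    induction r with
    | zero => intro i h; simp [d, Cell] at h
    | succ r ih =>
      intro i h
      rw [hd] at h ⊢
      exact ⟨h.1, hg _ _ _ ih h.2⟩
  let s : ℕ → Finset ℕ := fun r => (Finset.range N).filter fun i => Cell (d r) i
  have hs : ∀ r i, i ∈ s r ↔ Cell (d r) i := fun r i => by
    simp only [s, Finset.mem_filter, Finset.mem_range]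
    exact ⟨fun h => h.2, fun h => ⟨hlt r i h, h⟩⟩
  have hsub : ∀ r, s r ⊆ s (r + 1) := fun r i h => (hs _ _).2 (hmono r i ((hs _ _).1 h))
  have hstable : ∀ r, s (r + 1) ⊆ s r → s (r + 2) ⊆ s (r + 1) := by
    intro r h i hi
    rw [hs, hd] at hi
    rw [hs, hd]
    exact ⟨hi.1, hg _ _ _ (fun i hi => (hs _ _).1 (h ((hs _ _).2 hi))) hi.2⟩
  by_contra hcon
  have hne : ¬ s (N + 1) ⊆ s N := fun hsub =>
    hcon ((hs N i).1 (hsub ((hs _ _).2 ((hd _ _).2 ⟨hi, h⟩))))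
  -- Stability persists, so growth at stage `N` forces growth at every earlier stage: `N + 1` strict
  -- steps among only `N` cells.
  have hne' : ∀ t r, r + t = N → ¬ s (r + 1) ⊆ s r := by
    intro t
    induction t with
    | zero => rintro r rfl; exact hne
    | succ t ih => intro r hr h; exact ih (r + 1) (by omega) (hstable r h)
  have hcard : ∀ r ≤ N + 1, r ≤ (s r).card := by
    intro r
    induction r with
    | zero => intro _; exact Nat.zero_le _
    | succ r ih =>
      intro hr
      have h₁ := Finset.card_lt_card (Finset.ssubset_iff_subset_ne.2 ⟨hsub r, fun h =>
        hne' (N - r) r (by omega) (by rw [h])⟩)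
      have := ih (by omega)
      omega
  have h₁ := hcard (N + 1) le_rfl
  have h₂ : (s (N + 1)).card ≤ N := (Finset.card_filter_le _ _).trans_eq (Finset.card_range N)
  omega

/-! ### The rules for filling the table -/

namespace Instance

variable (lib : Bool) (I : Instance)

/-- `allowed` in terms of the input. -/
def Allowed (c x : ℕ) : Prop := lib = true ∨ I.one (x * I.n + x + c)

/-- `source` in terms of the input. -/
def Source (c x : ℕ) : Prop := if lib = true then I.one (x * I.n + x + x) else x = c

/-- `tokenMove` in terms of the input, the virtual individual having the number `n`. -/
def Move (c x y : ℕ) : Prop :=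
  y < I.n ∧ I.Allowed lib c y ∧ (I.Source lib c y ∨ (x < I.n ∧ I.one (x * I.n + x + y)))

/-- The cost `j - i` is that of the individual `y`. -/
def Cost (i y j : ℕ) : Prop :=
  (I.one ((I.n + 1) * I.n + I.n + 1 + y) ∧ i = j) ∨
    (¬ I.one ((I.n + 1) * I.n + I.n + 1 + y) ∧ i + 1 = j)

/-- The rules by which the entry `(c, j, a, b)` is obtained from those in `D`. For `c < n` it says
that tokens can be moved to `a` and `b` at cost `j`; for `c = n` and `j = 0` it says that `b` is at
most the number obtained from `|k|` by deleting `a` digits. -/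
def Rule (D : ℕ → ℕ → ℕ → ℕ → Prop) (c j a b : ℕ) : Prop :=
  (c = I.n ∧ j = 0 ∧ (b = 0 ∨ ∃ x < I.encode.length, ∃ i < I.encode.length,
      a + 1 = x ∧ D c j x i ∧ ((I.one ((I.n + 1 + 1) * I.n + I.n + 1 + 1 + 1 + a) ∧ b ≤ i + i + 1) ∨
        b ≤ i + i))) ∨
    (c < I.n ∧ ((a = I.n ∧ b = I.n ∧ j = 0) ∨ D c j b a ∨
      ∃ x < I.encode.length, ∃ i < I.encode.length, I.Move lib c x a ∧ I.Cost i a j ∧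
        ((a = b ∧ D c i x x) ∨ D c i x b)))

/-- The entries to be computed. -/
def Entry (c j a b : ℕ) : Prop :=
  (c = I.n → b ≤ I.budget a) ∧ (∀ h : c < I.n, ∃ x z : Option (Fin I.n),
    a = x.elim I.n (fun y => (y : ℕ)) ∧ b = z.elim I.n (fun y => (y : ℕ)) ∧
      Pair (tokenMove lib I.φ ⟨c, h⟩) (fun y => if y ∈ I.T then 0 else 1) j x z)

theorem allowed_iff (c x : Fin I.n) : I.Allowed lib c x ↔ allowed lib I.φ c x := by
  simp [Allowed, allowed, one_profile]

theorem source_iff (c x : Fin I.n) : I.Source lib c x ↔ source lib I.φ c x := by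
  simp [Source, source, one_profile, Fin.ext_iff]

theorem move_iff (c : Fin I.n) (x : Option (Fin I.n)) (y : Fin I.n) :
    I.Move lib c (x.elim I.n fun y => (y : ℕ)) y ↔ tokenMove lib I.φ c x y := by
  rw [Move, tokenMove, allowed_iff, source_iff]
  rcases x with _ | x
  · simp
  · simp [one_profile]

theorem cost_iff (i : ℕ) (y : Fin I.n) (j : ℕ) :
    I.Cost i y j ↔ i + (if y ∈ I.T then 0 else 1) = j := by
  rw [Cost, one_T]
  by_cases h : y ∈ I.T <;> simp [h]

/-! ### Soundness and completeness of the rules -/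

variable {lib I}

/-- Soundness of one application of the rules. `hD` concerns numbers below `L` only, because
distinct entries with larger numbers may share an address. -/
theorem entry_of_rule {D : ℕ → ℕ → ℕ → ℕ → Prop} {L : ℕ} (hL : L = I.encode.length)
    (hD : ∀ c < L, ∀ j < L, ∀ a < L, ∀ b < L, D c j a b → I.Entry lib c j a b)
    {c j a b : ℕ} (hc : c < L) (hj : j < L) (ha : a < L) (hb : b < L)
    (h : I.Rule lib D c j a b) : I.Entry lib c j a b := by
  subst hL
  rcases h with ⟨rfl, rfl, h⟩ | ⟨hcn, h⟩
  · refine ⟨fun _ => ?_, fun h => absurd h (lt_irrefl _)⟩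
    rw [budget_eq]
    rcases h with rfl | ⟨x, hx, i, hi, rfl, hd, h⟩
    · exact Nat.zero_le _
    · have := (hD _ hc _ hj _ hx _ hi hd).1 rfl
      rcases h with ⟨h₁, h₂⟩ | h₂
      · unfold one at h₁
        rw [if_pos h₁]
        omega
      · omega
  · refine ⟨fun h => absurd hcn (by omega), fun _ => ?_⟩
    rcases h with ⟨rfl, rfl, rfl⟩ | h | ⟨x, hx, i, hi, hm, hcost, h⟩
    · exact ⟨none, none, rfl, rfl, .root⟩
    · obtain ⟨x, z, h₁, h₂, hp⟩ := (hD _ hc _ hj _ hb _ ha h).2 hcn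
      exact ⟨z, x, h₂, h₁, hp.swap⟩
    · obtain ⟨y, rfl⟩ : ∃ y : Fin I.n, a = y := ⟨⟨a, hm.1⟩, rfl⟩
      rw [cost_iff] at hcost
      subst hcost
      rcases h with ⟨rfl, hd⟩ | hd
      · obtain ⟨x', z', h₁, h₂, hp⟩ := (hD _ hc _ hi _ hx _ hx hd).2 hcn
        -- The coding of positions is injective, since `n` is not the number of an individual.
        obtain rfl : x' = z' := by
          rcases x' with _ | x' <;> rcases z' with _ | z'
          · rfl
          · have := z'.2
            simp at h₁ h₂
            omega
          · have := x'.2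
            simp at h₁ h₂
            omega
          · simp at h₁ h₂
            exact congrArg some (Fin.ext (h₁.symm.trans h₂))
        rw [h₁] at hm
        exact ⟨some y, some y, rfl, rfl, hp.both ((I.move_iff lib ⟨c, hcn⟩ _ _).1 hm)⟩
      · obtain ⟨x', z', h₁, h₂, hp⟩ := (hD _ hc _ hi _ hx _ hb hd).2 hcn
        rw [h₁] at hm
        exact ⟨some y, z', rfl, h₂, hp.left ((I.move_iff lib ⟨c, hcn⟩ _ _).1 hm)⟩

theorem elim_lt_length (x : Option (Fin I.n)) :
    x.elim I.n (fun y => (y : ℕ)) < I.encode.length := by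
  have := I.n_lt_length
  rcases x with _ | x
  · exact this
  · exact x.2.trans this

variable {D : ℕ → ℕ → ℕ → ℕ → Prop} {L : ℕ}

/-- Downward induction on `a`: at `a = L - 1` no digit is left and the budget is zero, and each step
back restores one digit. -/
theorem of_le_budget (hL : L = I.encode.length)
    (hD : ∀ c < L, ∀ j < L, ∀ a < L, ∀ b < L, I.Rule lib D c j a b → D c j a b) {a b : ℕ} (ha : a < L)
    (hb : b < L) (h : b ≤ I.budget a) : D I.n 0 a b := by
  have hn : I.n < L := hL ▸ I.n_lt_length
  obtain ⟨t, ht⟩ := Nat.exists_eq_add_of_lt ha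
  induction t generalizing a b with
  | zero =>
    have := I.budget_length (i := a) (by omega)
    exact hD _ hn _ (by omega) _ ha _ hb (.inl ⟨rfl, rfl, .inl (by omega)⟩)
  | succ t ih =>
    rw [budget_eq] at h
    -- The budget may exceed `L`; the minimum keeps the witness inside the table and still large
    -- enough for `b`.
    have hd := ih (a := a + 1) (b := min b (I.budget (a + 1))) (by omega) (by omega)
      (min_le_right _ _) (by omega)
    refine hD _ hn _ (by omega) _ ha _ hb (.inl ⟨rfl, rfl, .inr ⟨a + 1, by omega,
      min b (I.budget (a + 1)), by omega, rfl, hd, ?_⟩⟩)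
    split_ifs at h with h₁
    · exact .inl ⟨h₁, by omega⟩
    · exact .inr (by omega)

/-- Costs never decrease along a derivation, so a final cost below `L` keeps all intermediate
entries in the table. -/
theorem of_pair (hL : L = I.encode.length)
    (hD : ∀ c < L, ∀ j < L, ∀ a < L, ∀ b < L, I.Rule lib D c j a b → D c j a b)
    {c : Fin I.n} {j : ℕ} {x z : Option (Fin I.n)}
    (h : Pair (tokenMove lib I.φ c) (fun y => if y ∈ I.T then 0 else 1) j x z) (hj : j < L) :
    D c j (x.elim I.n fun y => (y : ℕ)) (z.elim I.n fun y => (y : ℕ)) := by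
  have hn : I.n < L := hL ▸ I.n_lt_length
  have hc := c.2.trans hn
  have hlt : ∀ x : Option (Fin I.n), x.elim I.n (fun y => (y : ℕ)) < L :=
    fun x => hL ▸ elim_lt_length x
  induction h with
  | root => exact hD _ hc _ hj _ hn _ hn (.inr ⟨c.2, .inl ⟨rfl, rfl, rfl⟩⟩)
  | @both j x y _ hxy ih =>
    refine hD _ hc _ hj _ (hlt (some y)) _ (hlt (some y)) (.inr ⟨c.2, .inr (.inr ?_)⟩)
    exact ⟨_, hL ▸ hlt x, j, by omega, (I.move_iff lib c x y).2 hxy, (I.cost_iff j y _).2 rfl,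
      .inl ⟨rfl, ih (by omega)⟩⟩
  | @left j x y z _ hxy ih =>
    refine hD _ hc _ hj _ (hlt (some y)) _ (hlt z) (.inr ⟨c.2, .inr (.inr ?_)⟩)
    exact ⟨_, hL ▸ hlt x, j, by omega, (I.move_iff lib c x y).2 hxy, (I.cost_iff j y _).2 rfl,
      .inr (ih (by omega))⟩
  | @swap j x z _ ih =>
    exact hD _ hc _ hj _ (hlt _) _ (hlt _) (.inr ⟨c.2, .inr (.inl (ih hj))⟩)

/-- The final condition, in terms of the input and the table. -/
def Final (lib : Bool) (I : Instance) (D : ℕ → ℕ → ℕ → ℕ → Prop) : Prop :=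
  ¬ I.one ((I.n + 1 + 1) * I.n + I.n + 1 + 1) ∧ ∃ c < I.encode.length, c < I.n ∧
    (∀ x < I.encode.length, x < I.n → I.one ((I.n + 1) * I.n + I.n + 1 + x) → I.Allowed lib c x) ∧
    ∃ j < I.encode.length, D I.n 0 0 j ∧ ∃ a < I.encode.length, ∃ b < I.encode.length,
      a < I.n ∧ b < I.n ∧ D c j a b ∧ ∀ x < I.encode.length, x < I.n →
        I.one (I.n * I.n + I.n + x) → I.one (a * I.n + a + x) ∨ I.one (b * I.n + b + x)

/-- It suffices that the table is sound and closed under the rules; it need not be identified with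
the least fixed point. -/
theorem final_iff (hI : IsDQC I.φ) (hL : L = I.encode.length)
    (h₁ : ∀ c < L, ∀ j < L, ∀ a < L, ∀ b < L, D c j a b → I.Entry lib c j a b)
    (h₂ : ∀ c < L, ∀ j < L, ∀ a < L, ∀ b < L, I.Rule lib D c j a b → D c j a b) :
    I.Final lib D ↔ I.IsYes (rule lib) := by
  have hn : I.n < L := hL ▸ I.n_lt_length
  rw [I.isYes_iff lib hI hn, Final, one_sign, ← hL]
  constructor
  · rintro ⟨hk, c, hcL, hc, hT, j, hjL, hj, a, haL, b, hbL, ha, hb, hd, hS⟩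
    obtain ⟨x, z, hx, hz, hp⟩ := (h₁ _ hcL _ hjL _ haL _ hbL hd).2 hc
    -- The entry `(n, 0, 0, j)` certifies `j ≤ |k|`, and the sign bit has excluded negative `k`.
    have hjk := (h₁ _ hn _ (by omega) _ (by omega) _ hjL hj).1 rfl
    rw [budget_zero] at hjk
    obtain rfl : x = some ⟨a, ha⟩ := by
      rcases x with _ | x
      · simp at hx; omega
      · simp at hx; exact congrArg some (Fin.ext hx.symm)
    obtain rfl : z = some ⟨b, hb⟩ := by
      rcases z with _ | z
      · simp at hz; omega
      · simp at hz; exact congrArg some (Fin.ext hz.symm)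
    refine ⟨⟨c, hc⟩, fun t ht => ?_, j, hjL, by omega, _, _, hp, fun s hs => ?_⟩
    · exact (I.allowed_iff lib ⟨c, hc⟩ t).1 (hT t (t.2.trans hn) t.2 ((I.one_T t).2 ht))
    · have := hS s (s.2.trans hn) s.2 ((I.one_S s).2 hs)
      rwa [I.one_profile ⟨a, ha⟩, I.one_profile ⟨b, hb⟩] at this
  · rintro ⟨c, hT, j, hjL, hjk, a, b, hp, hS⟩
    refine ⟨by omega, c, c.2.trans hn, c.2, fun x _ hx ht => ?_, j, hjL, ?_, a, a.2.trans hn, b,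
      b.2.trans hn, a.2, b.2, of_pair hL h₂ hp hjL, fun x _ hx hs => ?_⟩
    · exact (I.allowed_iff lib c ⟨x, hx⟩).2 (hT _ ((I.one_T ⟨x, hx⟩).1 ht))
    · refine of_le_budget hL h₂ (by omega) hjL ?_
      rw [budget_zero]
      omega
    · rw [I.one_profile a ⟨x, hx⟩, I.one_profile b ⟨x, hx⟩]
      exact hS _ ((I.one_S ⟨x, hx⟩).1 hs)

end Instance

/-! ### The rules as formulas -/

namespace Fml

open Step

def isOne (o : Option Sym) : Bool := o == some (some true)

def isSep (o : Option Sym) : Bool := o == some none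

def true' : Fml := .get .inp [] fun _ => true

def or (φ ψ : Fml) : Fml := .not (.and (.not φ) (.not ψ))

def all (k : Stack) (φ : Fml) : Fml := .not (.ex k (.not φ))

/-- The value of the term `t` is less than the length of `k`. -/
def lt (t : Term) (k : Stack) : Fml := .get k t Option.isSome

def eq (k k' : Stack) : Fml := .and (.not (.lt [add k] k')) (.not (.lt [add k'] k))

/-- The length of `k` exceeds the value of the term `t` by one. -/
def eqSucc (t : Term) (k : Stack) : Fml := .and (.lt t k) (.not (.lt (t ++ [inc]) k))

def isZero (k : Stack) : Fml := .not (.lt [] k)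

/-- The address of an entry, less one. -/
def address (c j a b : Stack) : Term := [add c, mul .inp, add j, mul .inp, add a, mul .inp, add b]

def cell (c j a b : Stack) : Fml := .get .tab (address c j a b ++ [inc]) isOne

def edge (x y : Stack) : Fml := .get .inp [add x, mul .vn, add x, add y] isOne

def memS (x : Stack) : Fml := .get .inp [add .vn, mul .vn, add .vn, add x] isOne

def memT (x : Stack) : Fml := .get .inp [add .vn, inc, mul .vn, add .vn, inc, add x] isOne

def sign : Fml := .get .inp [add .vn, inc, inc, mul .vn, add .vn, inc, inc] isOne

def bit (x : Stack) : Fml :=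
  .get .inp [add .vn, inc, inc, mul .vn, add .vn, inc, inc, inc, add x] isOne

/-- `vn` is the number of individuals. -/
def isN : Fml :=
  .and (.get .inp [add .vn] isSep) (.all .vx (.not (.and (.lt [add .vx] .vn)
    (.get .inp [add .vx] isSep))))

def allowed (lib : Bool) (c x : Stack) : Fml := if lib = true then true' else .edge x c

def source (lib : Bool) (c x : Stack) : Fml := if lib = true then .edge x x else .eq x c

def move (lib : Bool) (c x y : Stack) : Fml :=
  .and (.lt [add y] .vn) <| .and (allowed lib c y) <|
    .or (source lib c y) (.and (.lt [add x] .vn) (.edge x y))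

def cost (i y j : Stack) : Fml :=
  .or (.and (.memT y) (.eq i j)) (.and (.not (.memT y)) (.eqSucc [add i] j))

def rule (lib : Bool) : Fml :=
  .or (.and (.eq .vc .vn) <| .and (.isZero .vj) <| .or (.isZero .vb) <| .ex .vx <| .ex .vi <|
      .and (.eqSucc [add .va] .vx) <| .and (.cell .vc .vj .vx .vi) <|
      .or (.and (.bit .va) (.not (.lt [add .vi, add .vi, inc] .vb)))
        (.not (.lt [add .vi, add .vi] .vb)))
    (.and (.lt [add .vc] .vn) <|
      .or (.and (.eq .va .vn) (.and (.eq .vb .vn) (.isZero .vj))) <|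
      .or (.cell .vc .vj .vb .va) <| .ex .vx <| .ex .vi <|
      .and (move lib .vc .vx .va) <| .and (cost .vi .va .vj) <|
      .or (.and (.eq .va .vb) (.cell .vc .vi .vx .vx)) (.cell .vc .vi .vx .vb))

/-- The formula giving the new table. -/
def fill (lib : Bool) : Fml :=
  .ex .vn <| .and isN <| .ex .vc <| .ex .vj <| .ex .va <| .ex .vb <|
    -- `lt` compares a term with the length of a stack from below, so the equality is expressed with
    -- a shift by one. Entries therefore occupy addresses from one on, and cell 0 never holds a one.
    .and (.eqSucc (address .vc .vj .va .vb) .idx) (rule lib)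

/-- The formula giving the answer. -/
def final (lib : Bool) : Fml :=
  .ex .vn <| .and isN <| .and (.not sign) <| .ex .vc <| .and (.lt [add .vc] .vn) <|
    .and (.all .vx (.not (.and (.lt [add .vx] .vn)
      (.and (.memT .vx) (.not (allowed lib .vc .vx)))))) <|
    .ex .vj <| .and
      -- The address of the entry `(n, 0, 0, j)`, with the summands for the two zeros omitted.
      (.get .tab [add .vn, mul .inp, mul .inp, mul .inp, add .vj, inc] isOne) <|
    .ex .va <| .ex .vb <| .and (.lt [add .va] .vn) <| .and (.lt [add .vb] .vn) <|
    .and (.cell .vc .vj .va .vb) <| .all .vx <|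
      .not (.and (.lt [add .vx] .vn) (.and (.memS .vx)
        (.not (.or (.edge .va .vx) (.edge .vb .vx)))))

/-! ### Their meaning -/

section Meaning

variable {S : Stacks}

theorem eval_not {φ : Fml} : (not φ).eval S = true ↔ ¬ φ.eval S = true := by simp [eval]

theorem eval_and {φ ψ : Fml} : (and φ ψ).eval S = true ↔ φ.eval S = true ∧ ψ.eval S = true := by
  simp [eval]

theorem eval_or {φ ψ : Fml} : (or φ ψ).eval S = true ↔ φ.eval S = true ∨ ψ.eval S = true := by
  simp only [or, eval_not, eval_and]
  tauto

theorem eval_ex {k : Stack} {φ : Fml} : (ex k φ).eval S = true ↔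
    ∃ i < (S .inp).length, φ.eval (update S k (List.replicate i none)) = true := by simp [eval]

theorem eval_all {k : Stack} {φ : Fml} : (all k φ).eval S = true ↔
    ∀ i < (S .inp).length, φ.eval (update S k (List.replicate i none)) = true := by
  simp only [all, eval_not, eval_ex]
  push Not
  simp

theorem eval_lt {t : Term} {k : Stack} : (lt t k).eval S = true ↔ t.val S < (S k).length := by
  simp [lt, eval]

theorem eval_eq {k k' : Stack} : (eq k k').eval S = true ↔ (S k).length = (S k').length := by
  simp only [eq, eval_and, eval_not, eval_lt]
  simp [Term.val, Term.valFrom, Step.val]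
  omega

theorem eval_eqSucc {t : Term} {k : Stack} :
    (eqSucc t k).eval S = true ↔ t.val S + 1 = (S k).length := by
  simp only [eqSucc, eval_and, eval_not, eval_lt]
  simp [Term.val, Term.valFrom, Step.val]
  omega

theorem eval_isZero {k : Stack} : (isZero k).eval S = true ↔ (S k).length = 0 := by
  simp [isZero, eval_not, eval_lt, Term.val, Term.valFrom]

theorem eval_isOne {k : Stack} {t : Term} :
    (get k t isOne).eval S = true ↔ (S k)[t.val S]? = some (some true) := by
  simp [eval, isOne]

/-- The address of an entry, for inputs of length `m`. -/
def entryAddress (m c j a b : ℕ) : ℕ := ((c * m + j) * m + a) * m + b + 1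

theorem eval_cell {c j a b : Stack} : (cell c j a b).eval S = true ↔ Cell (S .tab)
    (entryAddress (S .inp).length (S c).length (S j).length (S a).length (S b).length) := by
  simp [cell, eval_isOne, Cell, entryAddress, address, Term.val, Term.valFrom, Step.val]

/-- The stacks hold the encoding of `I` and, on `vn`, the number of individuals. -/
structure Reads (I : Instance) (S : Stacks) : Prop where
  inp : S .inp = I.encode
  vn : (S .vn).length = I.n

variable {I : Instance}

theorem Reads.update (h : Reads I S) {k : Stack} (h₁ : k ≠ .inp) (h₂ : k ≠ .vn) (l : List Sym) :
    Reads I (update S k l) :=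
  ⟨by rw [Function.update_of_ne h₁.symm, h.inp], by rw [Function.update_of_ne h₂.symm, h.vn]⟩

theorem Reads.eval_edge (h : Reads I S) {x y : Stack} : (edge x y).eval S = true ↔
    I.one ((S x).length * I.n + (S x).length + (S y).length) := by
  simp [edge, eval_isOne, Instance.one, Term.val, Term.valFrom, Step.val, h.inp, h.vn]

theorem Reads.eval_memS (h : Reads I S) {x : Stack} : (memS x).eval S = true ↔
    I.one (I.n * I.n + I.n + (S x).length) := by
  simp [memS, eval_isOne, Instance.one, Term.val, Term.valFrom, Step.val, h.inp, h.vn]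

theorem Reads.eval_memT (h : Reads I S) {x : Stack} : (memT x).eval S = true ↔
    I.one ((I.n + 1) * I.n + I.n + 1 + (S x).length) := by
  simp [memT, eval_isOne, Instance.one, Term.val, Term.valFrom, Step.val, h.inp, h.vn]

theorem Reads.eval_sign (h : Reads I S) : sign.eval S = true ↔
    I.one ((I.n + 1 + 1) * I.n + I.n + 1 + 1) := by
  simp [sign, eval_isOne, Instance.one, Term.val, Term.valFrom, Step.val, h.inp, h.vn]

theorem Reads.eval_bit (h : Reads I S) {x : Stack} : (bit x).eval S = true ↔
    I.one ((I.n + 1 + 1) * I.n + I.n + 1 + 1 + 1 + (S x).length) := by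
  simp [bit, eval_isOne, Instance.one, Term.val, Term.valFrom, Step.val, h.inp, h.vn]

theorem eval_isN (h : S .inp = I.encode) : isN.eval S = true ↔ (S .vn).length = I.n := by
  rw [← I.eq_n_iff]
  simp only [isN, eval_and, eval_all, eval_not, eval_lt]
  simp only [eval, isSep, Term.val, Term.valFrom, Step.val, List.foldl_cons, List.foldl_nil,
    Function.update_self, List.length_replicate, zero_add, beq_iff_eq, h, not_and, ne_eq,
    Function.update_of_ne (show Stack.inp ≠ .vx by decide),
    Function.update_of_ne (show Stack.vn ≠ .vx by decide)]
  constructor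
  · rintro ⟨h₁, h₂⟩
    -- A position holding a separator is less than the input length, so the bound on the quantifier
    -- loses nothing.
    obtain ⟨hlt, -⟩ := List.getElem?_eq_some_iff.1 h₁
    exact ⟨h₁, fun i hi => h₂ i (hi.trans hlt) hi⟩
  · rintro ⟨h₁, h₂⟩
    exact ⟨h₁, fun i _ hi => h₂ i hi⟩

theorem Reads.eval_allowed (h : Reads I S) {lib : Bool} {c x : Stack} :
    (allowed lib c x).eval S = true ↔ I.Allowed lib (S c).length (S x).length := by
  cases lib
  · simp [allowed, Instance.Allowed, h.eval_edge]
  · simp [allowed, Instance.Allowed, true', eval]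

theorem Reads.eval_source (h : Reads I S) {lib : Bool} {c x : Stack} :
    (source lib c x).eval S = true ↔ I.Source lib (S c).length (S x).length := by
  cases lib
  · simp [source, Instance.Source, eval_eq]
  · simp [source, Instance.Source, h.eval_edge]

theorem Reads.eval_move (h : Reads I S) {lib : Bool} {c x y : Stack} :
    (move lib c x y).eval S = true ↔ I.Move lib (S c).length (S x).length (S y).length := by
  simp only [move, eval_and, eval_or, eval_lt, h.eval_allowed, h.eval_source, h.eval_edge]
  simp [Instance.Move, Term.val, Term.valFrom, Step.val, h.vn]

theorem Reads.eval_cost (h : Reads I S) {i y j : Stack} :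
    (cost i y j).eval S = true ↔ I.Cost (S i).length (S y).length (S j).length := by
  simp only [cost, eval_and, eval_or, eval_not, eval_eq, eval_eqSucc, h.eval_memT]
  simp [Instance.Cost, Term.val, Term.valFrom, Step.val]

/-- The entries in the table `d`, for inputs of length `m`. -/
def InTable (m : ℕ) (d : List Sym) (c j a b : ℕ) : Prop := Cell d (entryAddress m c j a b)

theorem Reads.eval_rule (h : Reads I S) {lib : Bool} : (rule lib).eval S = true ↔
    I.Rule lib (InTable I.encode.length (S .tab)) (S .vc).length (S .vj).length (S .va).length
      (S .vb).length := by
  have h' : ∀ l l', Reads I (Function.update (Function.update S .vx l) .vi l') := fun l l' =>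
    (h.update (by decide) (by decide) l).update (by decide) (by decide) l'
  simp only [rule, eval_and, eval_or, eval_not, eval_eq, eval_eqSucc, eval_ex, eval_lt, eval_cell,
    eval_isZero, (h' _ _).eval_move, (h' _ _).eval_cost, (h' _ _).eval_bit]
  simp [Instance.Rule, InTable, Term.val, Term.valFrom, Step.val, h.vn, h.inp,
    Function.update_apply]

/-- Since `isN` has exactly one solution, the quantifier acts as a definition of `vn`. -/
theorem eval_ex_isN (h : S .inp = I.encode) {φ : Fml} : (ex .vn (and isN φ)).eval S = true ↔
    φ.eval (update S .vn (List.replicate I.n none)) = true := by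
  have h' : ∀ i, update S .vn (List.replicate i none) .inp = I.encode := fun i => by
    rw [Function.update_of_ne (by decide), h]
  simp only [eval_ex, eval_and, eval_isN (h' _), Function.update_self, List.length_replicate]
  constructor
  · rintro ⟨_, -, rfl, h⟩
    exact h
  · exact fun hφ => ⟨I.n, h ▸ I.n_lt_length, rfl, hφ⟩

theorem reads_vn (h : S .inp = I.encode) :
    Reads I (update S .vn (List.replicate I.n none)) :=
  ⟨by rw [Function.update_of_ne (by decide), h], by simp⟩

theorem eval_fill (h : S .inp = I.encode) {lib : Bool} : (fill lib).eval S = true ↔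
    ∃ c < I.encode.length, ∃ j < I.encode.length, ∃ a < I.encode.length, ∃ b < I.encode.length,
      entryAddress I.encode.length c j a b = (S .idx).length ∧
        I.Rule lib (InTable I.encode.length (S .tab)) c j a b := by
  have h' := fun c j a b => ((((reads_vn h).update (k := .vc) (by decide) (by decide) c).update
    (k := .vj) (by decide) (by decide) j).update (k := .va) (by decide) (by decide) a).update
    (k := .vb) (by decide) (by decide) b
  rw [fill, eval_ex_isN h]
  simp only [eval_ex, eval_and, eval_eqSucc, (h' _ _ _ _).eval_rule]
  simp [address, entryAddress, Term.val, Term.valFrom, Step.val, h, Function.update_apply]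

theorem eval_final (h : S .inp = I.encode) {lib : Bool} : (final lib).eval S = true ↔
    I.Final lib (InTable I.encode.length (S .tab)) := by
  have h₀ := reads_vn h
  have h₁ := fun c x => (h₀.update (k := .vc) (by decide) (by decide) c).update
    (k := .vx) (by decide) (by decide) x
  have h₂ := fun c j a b x => ((((h₀.update (k := .vc) (by decide) (by decide) c).update
    (k := .vj) (by decide) (by decide) j).update (k := .va) (by decide) (by decide) a).update
    (k := .vb) (by decide) (by decide) b).update (k := .vx) (by decide) (by decide) x
  rw [final, eval_ex_isN h]
  simp only [eval_ex, eval_all, eval_and, eval_or, eval_not, eval_lt, h₀.eval_sign,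
    (h₁ _ _).eval_memT, (h₁ _ _).eval_allowed, eval_isOne, eval_cell, (h₂ _ _ _ _ _).eval_memS,
    (h₂ _ _ _ _ _).eval_edge]
  simp [Instance.Final, InTable, Cell, entryAddress, Term.val, Term.valFrom, Step.val, h,
    Function.update_apply, or_iff_not_imp_left]

end Meaning

end Fml

/-! ### The theorem -/

/-- Up to the shift by one, `c, j, a, b` are the four digits of the address in base `m`. -/
theorem entryAddress_lt {m c j a b : ℕ} (hc : c < m) (hj : j < m) (ha : a < m) (hb : b < m) :
    Fml.entryAddress m c j a b < tableSize m := by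
  have step : ∀ {x y p : ℕ}, x < p → y < m → x * m + y < p * m := by
    intro x y p hx hy
    calc x * m + y < (x + 1) * m := by rw [Nat.add_mul]; omega
      _ ≤ p * m := Nat.mul_le_mul_right _ hx
  have := step (step (step hc hj) ha) hb
  unfold Fml.entryAddress tableSize
  rw [show m ^ 4 = m * m * m * m by ring]
  omega

theorem entryAddress_inj {m c j a b c' j' a' b' : ℕ} (hj : j < m) (ha : a < m) (hb : b < m)
    (hj' : j' < m) (ha' : a' < m) (hb' : b' < m)
    (h : Fml.entryAddress m c j a b = Fml.entryAddress m c' j' a' b') :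
    c = c' ∧ j = j' ∧ a = a' ∧ b = b' := by
  have step : ∀ {x y x' y' : ℕ}, y < m → y' < m → x * m + y = x' * m + y' → x = x' ∧ y = y' := by
    intro x y x' y' hy hy' h
    have h₁ : (x * m + y) / m = (x' * m + y') / m := by rw [h]
    rw [mul_comm x, mul_comm x', Nat.mul_add_div (by omega), Nat.mul_add_div (by omega),
      Nat.div_eq_of_lt hy, Nat.div_eq_of_lt hy'] at h₁
    obtain rfl : x = x' := by simpa using h₁
    exact ⟨rfl, by omega⟩
  obtain ⟨h, hbb⟩ := step hb hb' (Nat.succ_injective h)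
  obtain ⟨h, haa⟩ := step ha ha' h
  obtain ⟨hcc, hjj⟩ := step hj hj' h
  exact ⟨hcc, hjj, haa, hbb⟩

/-- `D` occurs only positively in the rules; this is the monotonicity needed for saturation. -/
theorem Instance.Rule.mono {lib : Bool} {I : Instance} {D D' : ℕ → ℕ → ℕ → ℕ → Prop}
    (h : ∀ c j a b, D c j a b → D' c j a b) {c j a b : ℕ} (hr : I.Rule lib D c j a b) :
    I.Rule lib D' c j a b := by
  rcases hr with ⟨h₁, h₂, h₃⟩ | ⟨h₁, h₂⟩
  · refine .inl ⟨h₁, h₂, h₃.imp_right ?_⟩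
    rintro ⟨x, hx, i, hi, h₄, h₅, h₆⟩
    exact ⟨x, hx, i, hi, h₄, h _ _ _ _ h₅, h₆⟩
  · refine .inr ⟨h₁, h₂.imp_right (Or.imp (h _ _ _ _) ?_)⟩
    rintro ⟨x, hx, i, hi, h₄, h₅, h₆⟩
    exact ⟨x, hx, i, hi, h₄, h₅, h₆.imp (And.imp_right (h _ _ _ _)) (h _ _ _ _)⟩

/-- The value of the formula `φ` for the table `d` at the address `i`. -/
def tableStep (φ : Fml) (w d : List Sym) (i : ℕ) : Bool :=
  φ.eval (Function.update (Function.update (Cmd.initStacks w) .tab d) .idx (List.replicate i none))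

theorem tableStep_iff (lib : Bool) (I : Instance) (d : List Sym) (i : ℕ) :
    tableStep (.fill lib) I.encode d i = true ↔
    ∃ c < I.encode.length, ∃ j < I.encode.length, ∃ a < I.encode.length, ∃ b < I.encode.length,
      Fml.entryAddress I.encode.length c j a b = i ∧
        I.Rule lib (Fml.InTable I.encode.length d) c j a b := by
  rw [tableStep, Fml.eval_fill (I := I) (by simp [Cmd.initStacks])]
  simp

/-- The final table answers the question. -/
theorem final_table_iff (lib : Bool) (I : Instance) (hI : IsDQC I.φ) :
    I.Final lib (Fml.InTable I.encode.length ((nextTable (tableStep (.fill lib) I.encode)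
      I.encode.length)^[tableSize I.encode.length] [])) ↔ I.IsYes (rule lib) := by
  refine Instance.final_iff hI rfl ?_ ?_
  -- Soundness holds at every stage of the iteration, whereas closure under the rules needs the
  -- saturated table.
  · have key : ∀ r, ∀ c < I.encode.length, ∀ j < I.encode.length, ∀ a < I.encode.length,
        ∀ b < I.encode.length, Fml.InTable I.encode.length
          ((nextTable (tableStep (.fill lib) I.encode) I.encode.length)^[r] []) c j a b →
          I.Entry lib c j a b := by
      intro r
      induction r with
      | zero => intro c _ j _ a _ b _ h; simp [Fml.InTable, Cell] at h
      | succ r ih =>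
        intro c hc j hj a ha b hb h
        rw [Function.iterate_succ_apply', Fml.InTable, cell_nextTable, tableStep_iff] at h
        obtain ⟨-, c', hc', j', hj', a', ha', b', hb', he, h⟩ := h
        obtain ⟨rfl, rfl, rfl, rfl⟩ := entryAddress_inj hj' ha' hb' hj ha hb he
        exact Instance.entry_of_rule rfl ih hc hj ha hb h
    exact key _
  · intro c hc j hj a ha b hb h
    refine cell_iterate_of_eval ?_ (entryAddress_lt hc hj ha hb)
      ((tableStep_iff ..).2 ⟨c, hc, j, hj, a, ha, b, hb, rfl, h⟩)
    intro d d' i hd h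
    rw [tableStep_iff] at h ⊢
    obtain ⟨c, hc, j, hj, a, ha, b, hb, he, h⟩ := h
    exact ⟨c, hc, j, hj, a, ha, b, hb, he, h.mono fun _ _ _ _ => hd _⟩

theorem polyTimeSolvableOn_rule (lib : Bool) :
    PolyTimeSolvableOn Instance.encode (fun I => IsDQC I.φ) (Instance.IsYes (rule lib)) := by
  classical
  obtain ⟨P, hP⟩ := Cmd.exists_runs_iterate (.fill lib) (.final lib) (by cases lib <;> decide)
    (by cases lib <;> decide) (by cases lib <;> decide) (by cases lib <;> decide)
  -- The answer is defined classically; the content lies in the run of the program that produces it.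
  refine ⟨fun I => decide (I.1.IsYes (rule lib)), fun I => by simp,
    Cmd.polyTime_of_runs _ _ (Cmd.iterate (.fill lib) (.final lib)) P fun I => ⟨none, ?_⟩⟩
  refine hP (tableStep (.fill lib) I.1.encode) _ _ ?_ ?_
  · intro S hS
    rw [Bool.eq_iff_iff, tableStep_iff, Fml.eval_fill hS]
  · intro S hS hS'
    rw [Bool.eq_iff_iff, Fml.eval_final hS, hS', final_table_iff lib I.1 I.2, decide_eq_true_eq]

end GroupIdent

theorem mainTheorem6 :
    GroupIdent.PolyTimeSolvableOn GroupIdent.Instance.encode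
        (fun I => GroupIdent.IsDQC I.φ) (GroupIdent.Instance.IsYes GroupIdent.csr) ∧
      GroupIdent.PolyTimeSolvableOn GroupIdent.Instance.encode
        (fun I => GroupIdent.IsDQC I.φ) (GroupIdent.Instance.IsYes GroupIdent.lsr) :=
  ⟨GroupIdent.polyTimeSolvableOn_rule false, GroupIdent.polyTimeSolvableOn_rule true⟩
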